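/- Proposition (Convergence of the quasi-Newton PDHG method). Let $\mathcal H_1,\mathcal H_2$ be real Hilbert spaces, $\mathcal H=\mathcal H_1\times\mathcal H_2$, and $K:\mathcal H_1\to\mathcal H_2$ bounded and linear. Let $g,f$ (on $\mathcal H_1$, $\mathcal H_2$) be proper lower semicontinuous convex with values in $\mathbb R\cup\{+\infty\}$, and let $G:\mathcal H_1\to\mathbb R$, $F:\mathcal H_2\to\mathbb R$ be convex and continuously differentiable with $\tfrac1\beta$-Lipschitz gradients, $\beta>0$ (so that $B(x,y)=(\nabla G(x),\nabla F(y))$ is $\beta$-cocoercive). Assume that $$\min_{x}\max_{y}\ g(x)+G(x)+\langle Kx,y\rangle-f(y)-F(y)$$ has a saddle point, i.e. a point $(x^*,y^*)\in\operatorname{dom}g\times\operatorname{dom}f$ with $L(x^*,y)\le L(x^*,y^*)\le L(x,y^*)$ for all $x,y$, where $L$ is the objective. Let $\mathcal T,\Sigma$ be bounded self-adjoint positive operators on $\mathcal H_1$, $\mathcal H_2$ with bounded inverses, $\mathrm{prox}^{\mathcal T}_g(u)=\operatorname{argmin}_v\, g(v)+\frac12\langle\mathcal T^{-1}(v-u),v-u\rangle$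 (similarly $\mathrm{prox}^\Sigma_f$), and $$M=\begin{pmatrix}\mathcal T^{-1}&-K^*\\-K&\Sigma^{-1}\end{pmatrix},\qquad M_k=M+s_kU_kU_k^*,\quad s_k\in\{1,-1\},\quad U_k=(U_{k,x},U_{k,y}):\mathbb R^r\to\mathcal H \text{ linear}\qquad (k\in\mathbb N).$$ For $\sigma>0$ let $\mathcal S_\sigma$ be the set of bounded self-adjoint $V$ on $\mathcal H$ with $\langle Vz,z\rangle\ge\sigma\|z\|^2$ for all $z$, and put $\|z\|_V=\sqrt{\langle Vz,z\rangle}$. Let $\epsilon_k=(\epsilon_{k,x},\epsilon_{k,y})\in\mathcal H$. Main step at $z=(x,y)$ in iteration $k$, with result $z^+=(x^+,y^+)$: $$x^+=\mathrm{prox}^{\mathcal T}_g\big(x-\mathcal T\nabla G(x)-\mathcal TK^*y-s_k\mathcal TU_{k,x}\xi_k\big)+\epsilon_{k,x},$$ $$y^+=\mathrm{prox}^{\Sigma}_f\big(y-\Sigma\nabla F(y)+\Sigma K(2x^+-x)-s_k\Sigma U_{k,y}\xi_k\big)+\epsilon_{k,y},$$ where $\xi_k\in\mathbb R^r$ solves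 $U_{k,x}^*(x(\xi)-x)+U_{k,y}^*(y(\xi)-y)-\xi=0$, and $x(\xi),y(\xi)$ are given by the same two formulas with $\xi$ in place of $\xi_k$, $x(\xi)$ in place of $x^+$, and without the errors. (i) Suppose that (Assumption 1) $M_k\in\mathcal S_\sigma$ for all $k$ and some $\sigma>0$; $\sup_k\|M_k\|<\infty$; there is a summable sequence $\eta_k\ge0$ with $(1+\eta_k)M_k\succeq M_{k+1}$ for all $k$; $M_k-\tfrac1{2\beta}\mathrm{Id}\in\mathcal S_{e}$ for all $k$ and some $e>0$; $\sum_k\|\epsilon_k\|<\infty$. Let $z_{-1},z_0\in\mathcal H$ be arbitrary and let $z_k=(x_k,y_k)$ be generated by the inertial quasi-Newton PDHG method: $z_{k+1}$ is the result of the main step at $\bar z_k=z_k+\alpha_k(z_k-z_{k-1})$, where $\alpha_k\in(0,\Lambda]$, $\Lambda<\infty$, and $\sum_k\alpha_k\max\{\|z_k-z_{k-1}\|_{M_k},\|z_k-z_{k-1}\|_{M_k}^2\}<\infty$. Then $(z_k)$ converges weakly to some saddle point $z^*$. If moreover $g$ and $f$ are both strongly convex, or $G$ and $F$ are both strongly convex,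 and if $\epsilon_k=0$ for all $k$ and $M_k-\tfrac1\beta\mathrm{Id}\in\mathcal S_{e}$ for all $k$ and some $e>0$, then there are $\xi\in(0,1)$, $\Theta>0$, $K_0\in\mathbb N$ such that for all $k\ge K_0$ $$\|z_k-z^*\|_{M_k}^2\le(1-\xi)^{k-K_0}\|z_{K_0}-z^*\|_{M_{K_0}}^2+\sum_{i=K_0}^{k-1}\Theta(1-\xi)^{k-i}\alpha_i\max\{\|z_i-z_{i-1}\|_{M_i},\|z_i-z_{i-1}\|_{M_i}^2\}.$$ (ii) Suppose that (Assumption 2) $M_k\in\mathcal S_\sigma$ for all $k$ and some $\sigma>0$; $M_k-\tfrac1\beta\mathrm{Id}\in\mathcal S_c$ for all $k$ and some $c>0$; $\sup_k\|M_k\|<\infty$; $\sum_k\|\epsilon_k\|<\infty$. Let $z_0\in\mathcal H$ be arbitrary and let $z_k=(x_k,y_k)$ be generated by the relaxed quasi-Newton PDHG method: $\tilde z_k$ is the result of the main step at $z_k$, $v_k=M_k(z_k-\tilde z_k)+B\tilde z_k-Bz_k$, $t_k=\langle z_k-\tilde z_k,v_k\rangle/(2\|v_k\|^2)$ ($t_k=0$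 if $v_k=0$), and $z_{k+1}=z_k-t_kv_k$. Then $(z_k)$ converges weakly to some saddle point $z^*$. If moreover $g$ and $f$ are both strongly convex, or $G$ and $F$ are both strongly convex, and $\epsilon_k=0$ for all $k$, then the convergence is linear: there is $\xi\in(0,1)$ with $\|z_k-z^*\|^2\le(1-\xi)^k\|z_0-z^*\|^2$ for all $k$. -/

import Mathlib

open Filter Topology
open scoped InnerProductSpace

noncomputable section

namespace QNPDHG

section General

variable {H : Type*} [NormedAddCommGroup H] [InnerProductSpace ℝ H] [CompleteSpace H]

/-- The class `𝒮_σ(H)`: bounded self-adjoint operators `U` with `⟪U x, x⟫ ≥ σ ‖x‖²` for all `x`. -/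
def InS (σ : ℝ) (U : H →L[ℝ] H) : Prop :=
  IsSelfAdjoint U ∧ ∀ x, σ * ‖x‖ ^ 2 ≤ ⟪U x, x⟫_ℝ

/-- The norm `‖z‖_M = √⟪M z, z⟫`. -/
def mnorm (M : H →L[ℝ] H) (z : H) : ℝ := √⟪M z, z⟫_ℝ

/-- Weak convergence of a sequence. -/
def WeaklyTendsto (z : ℕ → H) (z' : H) : Prop :=
  Tendsto (fun k => toWeakSpace ℝ H (z k)) atTop (𝓝 (toWeakSpace ℝ H z'))

/-- Assumption 1 on the metrics `M k` and the errors `ε k`, for a cocoercivity parameter `β`. -/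
structure Assumption1 (β : ℝ) (M : ℕ → H →L[ℝ] H) (ε : ℕ → H) : Prop where
  mem : ∃ σ > 0, ∀ k, InS σ (M k)
  bdd : BddAbove (Set.range fun k => ‖M k‖)
  mono : ∃ η : ℕ → ℝ, (∀ k, 0 ≤ η k) ∧ Summable η ∧
    ∀ k x, ⟪M (k + 1) x, x⟫_ℝ ≤ (1 + η k) * ⟪M k x, x⟫_ℝ
  lower : ∃ e > 0, ∀ k, InS e (M k - (1 / (2 * β)) • ContinuousLinearMap.id ℝ H)
  err : Summable fun k => ‖ε k‖

/-- Assumption 2 on the metrics `M k` and the errors `ε k`, for a cocoercivity parameter `β`. -/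
structure Assumption2 (β : ℝ) (M : ℕ → H →L[ℝ] H) (ε : ℕ → H) : Prop where
  mem : ∃ σ > 0, ∀ k, InS σ (M k)
  lower : ∃ c > 0, ∀ k, InS c (M k - (1 / β) • ContinuousLinearMap.id ℝ H)
  bdd : BddAbove (Set.range fun k => ‖M k‖)
  err : Summable fun k => ‖ε k‖

/-- The inequality `g (a x + b y) + (μ / 2) a b ‖x - y‖² ≤ a g x + b g y` for all `x`, `y` and
`a, b > 0`, `a + b = 1`: convexity for `μ = 0`, strong convexity with modulus `μ` for `μ > 0`. -/
def ConvexWithModulus (μ : ℝ) (g : H → EReal) : Prop :=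
  ∀ x y : H, ∀ a b : ℝ, 0 < a → 0 < b → a + b = 1 →
    g (a • x + b • y) + ((μ / 2 * a * b * ‖x - y‖ ^ 2 : ℝ) : EReal) ≤
      (a : EReal) * g x + (b : EReal) * g y

/-- Proper, lower semicontinuous and convex extended real valued functions. -/
structure ProperConvexLSC (g : H → EReal) : Prop where
  ne_bot : ∀ x, g x ≠ ⊥
  exists_ne_top : ∃ x, g x ≠ ⊤
  lsc : LowerSemicontinuous g
  convex : ConvexWithModulus 0 g

/-- Strong convexity of an extended real valued function. -/
def StronglyConvexE (g : H → EReal) : Prop := ∃ μ > 0, ConvexWithModulus μ g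

/-- Convex, continuously differentiable, with `L`-Lipschitz gradient. -/
structure SmoothConvex (L : ℝ) (G : H → ℝ) : Prop where
  convex : ConvexOn ℝ Set.univ G
  contDiff : ContDiff ℝ 1 G
  lipschitz : ∀ x y, ‖gradient G x - gradient G y‖ ≤ L * ‖x - y‖

/-- Step-size operators: self-adjoint, positive, with bounded inverse. -/
def IsStepOperator (T : H ≃L[ℝ] H) : Prop := (T : H →L[ℝ] H).IsPositive

/-- `p = prox_g^T (u)`: `p` minimises `v ↦ g v + (1/2) ⟪T⁻¹ (v - u), v - u⟫`. -/
def IsProx (T : H ≃L[ℝ] H) (g : H → EReal) (u p : H) : Prop :=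
  ∀ v, g p + ((1 / 2 * ⟪T.symm (p - u), p - u⟫_ℝ : ℝ) : EReal) ≤
    g v + ((1 / 2 * ⟪T.symm (v - u), v - u⟫_ℝ : ℝ) : EReal)

/-- The shifted sequence `k ↦ z_{k-1}`, where `zinit` plays the role of `z_{-1}`. -/
def prev (zinit : H) (z : ℕ → H) : ℕ → H
  | 0 => zinit
  | k + 1 => z k

end General

/-- The Hilbert space `H₁ × H₂`. -/
abbrev PD (H₁ H₂ : Type*) := WithLp 2 (H₁ × H₂)

/-- `ℝ^r` with its Euclidean structure. -/
abbrev Rn (r : ℕ) := EuclideanSpace ℝ (Fin r)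

variable {H₁ H₂ : Type*}
  [NormedAddCommGroup H₁] [InnerProductSpace ℝ H₁] [CompleteSpace H₁]
  [NormedAddCommGroup H₂] [InnerProductSpace ℝ H₂] [CompleteSpace H₂]

/-- The Lagrangian `g x + G x + ⟪K x, y⟫ - f y - F y`. -/
def lagrangian (K : H₁ →L[ℝ] H₂) (g : H₁ → EReal) (f : H₂ → EReal) (G : H₁ → ℝ) (F : H₂ → ℝ)
    (x : H₁) (y : H₂) : EReal :=
  (g x + ((G x + ⟪K x, y⟫_ℝ : ℝ) : EReal)) - (f y + ((F y : ℝ) : EReal))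

/-- Saddle points (solutions of the min-max problem): points of `dom g × dom f` that satisfy the
saddle point inequalities.  In both inequalities no expression `∞ - ∞` occurs, as `g z.fst` and
`f z.snd` are finite (for proper `g`, `f`). -/
def IsSaddlePoint (K : H₁ →L[ℝ] H₂) (g : H₁ → EReal) (f : H₂ → EReal) (G : H₁ → ℝ) (F : H₂ → ℝ)
    (z : PD H₁ H₂) : Prop :=
  g z.fst ≠ ⊤ ∧ f z.snd ≠ ⊤ ∧
  (∀ x, lagrangian K g f G F z.fst z.snd ≤ lagrangian K g f G F x z.snd) ∧
  (∀ y, lagrangian K g f G F z.fst y ≤ lagrangian K g f G F z.fst z.snd)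

/-- The PDHG metric `(x, y) ↦ (T⁻¹ x - K* y, - K x + S⁻¹ y)`. -/
def pdhgMetric (K : H₁ →L[ℝ] H₂) (T : H₁ ≃L[ℝ] H₁) (S : H₂ ≃L[ℝ] H₂) :
    PD H₁ H₂ →L[ℝ] PD H₁ H₂ :=
  ((WithLp.prodContinuousLinearEquiv 2 ℝ H₁ H₂).symm : (H₁ × H₂) →L[ℝ] PD H₁ H₂) ∘L
    (((T.symm : H₁ →L[ℝ] H₁) ∘L ContinuousLinearMap.fst ℝ H₁ H₂ -
        (ContinuousLinearMap.adjoint K) ∘L ContinuousLinearMap.snd ℝ H₁ H₂).prod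
      (-(K ∘L ContinuousLinearMap.fst ℝ H₁ H₂) +
        (S.symm : H₂ →L[ℝ] H₂) ∘L ContinuousLinearMap.snd ℝ H₁ H₂)) ∘L
    ((WithLp.prodContinuousLinearEquiv 2 ℝ H₁ H₂) : PD H₁ H₂ →L[ℝ] (H₁ × H₂))

theorem pdhgMetric_apply (K : H₁ →L[ℝ] H₂) (T : H₁ ≃L[ℝ] H₁) (S : H₂ ≃L[ℝ] H₂)
    (z : PD H₁ H₂) :
    pdhgMetric K T S z = WithLp.toLp 2
      (T.symm z.fst - ContinuousLinearMap.adjoint K z.snd, -K z.fst + S.symm z.snd) := rfl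

/-- The first component `U_x` of `U = (U_x, U_y)`. -/
def fstOp {r : ℕ} (U : Rn r →L[ℝ] PD H₁ H₂) : Rn r →L[ℝ] H₁ :=
  ContinuousLinearMap.fst ℝ H₁ H₂ ∘L
    ((WithLp.prodContinuousLinearEquiv 2 ℝ H₁ H₂) : PD H₁ H₂ →L[ℝ] (H₁ × H₂)) ∘L U

/-- The second component `U_y` of `U = (U_x, U_y)`. -/
def sndOp {r : ℕ} (U : Rn r →L[ℝ] PD H₁ H₂) : Rn r →L[ℝ] H₂ :=
  ContinuousLinearMap.snd ℝ H₁ H₂ ∘L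
    ((WithLp.prodContinuousLinearEquiv 2 ℝ H₁ H₂) : PD H₁ H₂ →L[ℝ] (H₁ × H₂)) ∘L U

/-- The quasi-Newton metric `M + s U U*`, with `M` the PDHG metric and a sign `s`. -/
def qnMetric (K : H₁ →L[ℝ] H₂) (T : H₁ ≃L[ℝ] H₁) (S : H₂ ≃L[ℝ] H₂) {r : ℕ}
    (s : ℝ) (U : Rn r →L[ℝ] PD H₁ H₂) : PD H₁ H₂ →L[ℝ] PD H₁ H₂ :=
  pdhgMetric K T S + s • (U ∘L ContinuousLinearMap.adjoint U)

/-- Argument of the primal proximal map: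
`x - T ∇G(x) - T K* y - s T U_x ξ`, where `z = (x, y)`. -/
def primalArg (K : H₁ →L[ℝ] H₂) (G : H₁ → ℝ) (T : H₁ ≃L[ℝ] H₁) {r : ℕ}
    (s : ℝ) (U : Rn r →L[ℝ] PD H₁ H₂) (z : PD H₁ H₂) (ξ : Rn r) : H₁ :=
  z.fst - T (gradient G z.fst) - T (ContinuousLinearMap.adjoint K z.snd) - s • T (fstOp U ξ)

/-- Argument of the dual proximal map:
`y - S ∇F(y) + S K (2 x' - x) - s S U_y ξ`, where `z = (x, y)` and `x'` is the new primal
point. -/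
def dualArg (K : H₁ →L[ℝ] H₂) (F : H₂ → ℝ) (S : H₂ ≃L[ℝ] H₂) {r : ℕ}
    (s : ℝ) (U : Rn r →L[ℝ] PD H₁ H₂) (z : PD H₁ H₂) (ξ : Rn r) (x' : H₁) : H₂ :=
  z.snd - S (gradient F z.snd) + S (K ((2 : ℝ) • x' - z.fst)) - s • S (sndOp U ξ)

/-- `𝒥(ξ) = 0`, where, with `x(ξ)` and `y(ξ)` the (error free) proximal points computed from
`z = (x, y)`, `𝒥(ξ) = U_x* (x(ξ) - x) + U_y* (y(ξ) - y) - ξ`. -/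
def IsRootJ (K : H₁ →L[ℝ] H₂) (g : H₁ → EReal) (f : H₂ → EReal) (G : H₁ → ℝ) (F : H₂ → ℝ)
    (T : H₁ ≃L[ℝ] H₁) (S : H₂ ≃L[ℝ] H₂) {r : ℕ}
    (s : ℝ) (U : Rn r →L[ℝ] PD H₁ H₂) (z : PD H₁ H₂) (ξ : Rn r) : Prop :=
  ∃ (xξ : H₁) (yξ : H₂),
    IsProx T g (primalArg K G T s U z ξ) xξ ∧
    IsProx S f (dualArg K F S s U z ξ xξ) yξ ∧
    ContinuousLinearMap.adjoint (fstOp U) (xξ - z.fst) +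
      ContinuousLinearMap.adjoint (sndOp U) (yξ - z.snd) - ξ = 0

/-- `w` is a result of the main quasi-Newton PDHG step at `z` with error `ε`:
`w_x = prox_g^T(…) + ε_x` and `w_y = prox_f^S(…) + ε_y`, where the dual step uses `w_x`. -/
def IsMainStep (K : H₁ →L[ℝ] H₂) (g : H₁ → EReal) (f : H₂ → EReal) (G : H₁ → ℝ) (F : H₂ → ℝ)
    (T : H₁ ≃L[ℝ] H₁) (S : H₂ ≃L[ℝ] H₂) {r : ℕ}
    (s : ℝ) (U : Rn r →L[ℝ] PD H₁ H₂) (ε z w : PD H₁ H₂) : Prop :=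
  ∃ ξ : Rn r, IsRootJ K g f G F T S s U z ξ ∧
    IsProx T g (primalArg K G T s U z ξ) (w.fst - ε.fst) ∧
    IsProx S f (dualArg K F S s U z ξ w.fst) (w.snd - ε.snd)

/-- The sequence `z k = (x k, y k)` (with `z_{-1} = zinit`) is generated by the inertial
quasi-Newton PDHG method with extrapolation parameters `α k`. -/
def IsInertialQNPDHG (K : H₁ →L[ℝ] H₂) (g : H₁ → EReal) (f : H₂ → EReal) (G : H₁ → ℝ)
    (F : H₂ → ℝ) (T : H₁ ≃L[ℝ] H₁) (S : H₂ ≃L[ℝ] H₂) {r : ℕ}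
    (s : ℕ → ℝ) (U : ℕ → Rn r →L[ℝ] PD H₁ H₂) (ε : ℕ → PD H₁ H₂)
    (α : ℕ → ℝ) (zinit : PD H₁ H₂) (z : ℕ → PD H₁ H₂) : Prop :=
  ∀ k, IsMainStep K g f G F T S (s k) (U k) (ε k)
    (z k + α k • (z k - prev zinit z k)) (z (k + 1))

/-- The vector `v = M (z - w) + B w - B z` with `B (x, y) = (∇G x, ∇F y)`. -/
def relaxDir (G : H₁ → ℝ) (F : H₂ → ℝ) (M : PD H₁ H₂ →L[ℝ] PD H₁ H₂) (z w : PD H₁ H₂) :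
    PD H₁ H₂ :=
  M (z - w) + WithLp.toLp 2 (gradient G w.fst, gradient F w.snd) -
    WithLp.toLp 2 (gradient G z.fst, gradient F z.snd)

/-- The relaxation parameter `⟪z - w, v⟫ / (2 ‖v‖²)` (equal to `0` if `v = 0`, in which case the
relaxation step does not move the point). -/
def relaxParam (G : H₁ → ℝ) (F : H₂ → ℝ) (M : PD H₁ H₂ →L[ℝ] PD H₁ H₂) (z w : PD H₁ H₂) : ℝ :=
  ⟪z - w, relaxDir G F M z w⟫_ℝ / (2 * ‖relaxDir G F M z w‖ ^ 2)

/-- The sequence `z k = (x k, y k)` is generated by the quasi-Newton PDHG method with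
relaxation. -/
def IsRelaxedQNPDHG (K : H₁ →L[ℝ] H₂) (g : H₁ → EReal) (f : H₂ → EReal) (G : H₁ → ℝ)
    (F : H₂ → ℝ) (T : H₁ ≃L[ℝ] H₁) (S : H₂ ≃L[ℝ] H₂) {r : ℕ}
    (s : ℕ → ℝ) (U : ℕ → Rn r →L[ℝ] PD H₁ H₂) (ε : ℕ → PD H₁ H₂)
    (z : ℕ → PD H₁ H₂) : Prop :=
  ∀ k, ∃ w : PD H₁ H₂, IsMainStep K g f G F T S (s k) (U k) (ε k) (z k) w ∧
    z (k + 1) = z k -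
      relaxParam G F (qnMetric K T S (s k) (U k)) (z k) w •
        relaxDir G F (qnMetric K T S (s k) (U k)) (z k) w

/-- Both `g` and `f` are strongly convex, or both `G` and `F` are strongly convex. -/
def StrongConvexityCondition (g : H₁ → EReal) (f : H₂ → EReal) (G : H₁ → ℝ) (F : H₂ → ℝ) :
    Prop :=
  (StronglyConvexE g ∧ StronglyConvexE f) ∨
    ((∃ m > 0, StrongConvexOn Set.univ m G) ∧ (∃ m > 0, StrongConvexOn Set.univ m F))

end QNPDHG

end

open QNPDHG

namespace QNPDHG

/-! ### Quasi-Fejér sequences of real numbers. -/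

section Real

/-! Saddle points are the zeros of `A + B`, where `A (x, y) = (∂g x + K* y, ∂f y - K x)` is monotone
because its `K`-part is skew, and `B (x, y) = (∇G x, ∇F y)` is cocoercive by the Baillon–Haddad
theorem. The root equation for `ξ` says `ξ = U* (w - z)`, so the correction `s U ξ` in the proximal
arguments is exactly the low-rank part of the metric, while evaluating the dual step at `2 x' - x`
produces the off-diagonal blocks. Hence an exact main step is the forward-backward inclusion `M k (z
- w) - B z ∈ A w` (`pdRel_of_isProx`), and the prescribed errors perturb it only linearly
(`IsMainStep.exists_exact`).

For the inertial method, monotonicity of `A` and cocoercivity of `B` give a Fejér inequality in the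
norm of `M k` (`forwardBackward_step`). Inertia, errors and the change of metric are summable
perturbations, so the distances to every saddle point converge and the residuals vanish. For the
relaxed method, `v` almost defines a hyperplane separating the iterate from the saddle points, and
the step moves towards it; the Fejér inequality then holds in the original norm (`relaxation_step`),
so no monotonicity of the metrics is needed.

In both cases weak limit points are saddle points, because the gap inequality passes to weak limits
(`isSaddlePoint_of_weak_limit`), and Opial's argument (`exists_weaklyTendsto`) makes the limit
unique. Under strong convexity each Fejér inequality gains a multiple of a squared distance to the
solution, which turns it into a contraction. -/

theorem one_le_prod_one_add {η : ℕ → ℝ} (hη : ∀ k, 0 ≤ η k) (n : ℕ) :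
    1 ≤ ∏ j ∈ Finset.range n, (1 + η j) := by
  induction n with
  | zero => simp
  | succ n ih =>
    rw [Finset.prod_range_succ]
    nlinarith [hη n]

/-- The products increase, and `1 + t ≤ exp t` bounds them by the exponential of the sum. -/
theorem exists_tendsto_prod_one_add {η : ℕ → ℝ} (hη : ∀ k, 0 ≤ η k) (hs : Summable η) :
    ∃ c, Tendsto (fun n => ∏ j ∈ Finset.range n, (1 + η j)) atTop (𝓝 c) := by
  have hmono : Monotone fun n => ∏ j ∈ Finset.range n, (1 + η j) := by
    refine monotone_nat_of_le_succ fun n => ?_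
    rw [Finset.prod_range_succ]
    have := one_le_prod_one_add hη n
    nlinarith [hη n]
  refine ⟨_, tendsto_atTop_ciSup hmono ⟨Real.exp (∑' j, η j), ?_⟩⟩
  rintro _ ⟨n, rfl⟩
  calc ∏ j ∈ Finset.range n, (1 + η j) ≤ ∏ j ∈ Finset.range n, Real.exp (η j) :=
        Finset.prod_le_prod (fun i _ => by linarith [hη i])
          fun i _ => by linarith [Real.add_one_le_exp (η i)]
    _ = Real.exp (∑ j ∈ Finset.range n, η j) := (Real.exp_sum _ _).symm
    _ ≤ Real.exp (∑' j, η j) := Real.exp_le_exp.2 (hs.sum_le_tsum _ fun i _ => hη i)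

/-- A quasi-Fejér sequence of nonnegative numbers converges. -/
theorem exists_tendsto_of_quasiFejer {a η γ : ℕ → ℝ} (ha : ∀ k, 0 ≤ a k) (hη : ∀ k, 0 ≤ η k)
    (hηs : Summable η) (hγ : ∀ k, 0 ≤ γ k) (hγs : Summable γ)
    (h : ∀ k, a (k + 1) ≤ (1 + η k) * (a k + γ k)) : ∃ l, Tendsto a atTop (𝓝 l) := by
  obtain ⟨c, hc⟩ := exists_tendsto_prod_one_add hη hηs
  set P : ℕ → ℝ := fun n => ∏ j ∈ Finset.range n, (1 + η j) with hP
  have hP1 : ∀ n, 1 ≤ P n := one_le_prod_one_add hη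
  -- Dividing by the partial products absorbs the factors `1 + η n`; subtracting the partial sums of
  -- `γ` absorbs the additive errors.
  have hanti : Antitone fun n => a n / P n - ∑ j ∈ Finset.range n, γ j := by
    refine antitone_nat_of_succ_le fun n => ?_
    have h1 : P (n + 1) = P n * (1 + η n) := Finset.prod_range_succ _ _
    have hn := hP1 n
    have hη1 : 0 < 1 + η n := by linarith [hη n]
    have h2 : a (n + 1) / P (n + 1) ≤ a n / P n + γ n := by
      rw [h1]
      calc a (n + 1) / (P n * (1 + η n)) ≤ (1 + η n) * (a n + γ n) / (P n * (1 + η n)) := by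
            gcongr; exact h n
        _ = a n / P n + γ n / P n := by field_simp
        _ ≤ a n / P n + γ n := by gcongr; exact div_le_self (hγ n) hn
    rw [Finset.sum_range_succ]
    linarith
  have hlim := tendsto_atTop_ciInf hanti ⟨-∑' j, γ j, by
    rintro _ ⟨n, rfl⟩
    have := hγs.sum_le_tsum (Finset.range n) fun i _ => hγ i
    have h0 : 0 ≤ a n / P n := div_nonneg (ha n) (by linarith [hP1 n])
    dsimp only
    linarith⟩
  have h1 := hc.mul (hlim.add hγs.hasSum.tendsto_sum_nat)
  refine ⟨_, h1.congr fun n => ?_⟩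
  have : P n ≠ 0 := by linarith [hP1 n]
  rw [sub_add_cancel]
  field_simp

end Real

variable {H : Type*} [NormedAddCommGroup H] [InnerProductSpace ℝ H]

/-! ### Seminorms of positive operators. -/

section Metric

theorem inner_apply_comm [CompleteSpace H] {M : H →L[ℝ] H} (hM : IsSelfAdjoint M) (x y : H) :
    ⟪M x, y⟫_ℝ = ⟪M y, x⟫_ℝ := by
  rw [hM.isSymmetric.apply_clm x y, real_inner_comm]

theorem InS.pos [CompleteSpace H] {σ : ℝ} (hσ : 0 ≤ σ) {M : H →L[ℝ] H} (hM : InS σ M) (x : H) :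
    0 ≤ ⟪M x, x⟫_ℝ := le_trans (by positivity) (hM.2 x)

theorem inner_apply_self_le (M : H →L[ℝ] H) (x : H) : ⟪M x, x⟫_ℝ ≤ ‖M‖ * ‖x‖ ^ 2 := by
  have := real_inner_le_norm (M x) x
  have := M.le_opNorm x
  nlinarith [norm_nonneg x]

/-- For a positive operator `A` with `‖A‖ ≤ N` one has `‖A x‖² ≤ N ⟪A x, x⟫`. -/
theorem norm_apply_sq_le_of_pos {A : H →L[ℝ] H} (hs : ∀ x y, ⟪A x, y⟫_ℝ = ⟪A y, x⟫_ℝ)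
    (hp : ∀ x, 0 ≤ ⟪A x, x⟫_ℝ) {N : ℝ} (hN : 0 < N) (hA : ‖A‖ ≤ N) (x : H) :
    ‖A x‖ ^ 2 ≤ N * ⟪A x, x⟫_ℝ := by
  have h1 := hp (x - (1 / N) • A x)
  have h2 : ⟪A (A x), A x⟫_ℝ ≤ N * ‖A x‖ ^ 2 :=
    (inner_apply_self_le A (A x)).trans (by gcongr)
  have h3 : ⟪A (x - (1 / N) • A x), x - (1 / N) • A x⟫_ℝ =
      ⟪A x, x⟫_ℝ - 2 * (1 / N) * ‖A x‖ ^ 2 + (1 / N) ^ 2 * ⟪A (A x), A x⟫_ℝ := by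
    rw [map_sub, map_smul]
    simp only [inner_sub_left, inner_sub_right, real_inner_smul_left, real_inner_smul_right]
    rw [hs (A x) x, real_inner_self_eq_norm_sq]
    ring
  have h4 : (1 / N) ^ 2 * ⟪A (A x), A x⟫_ℝ ≤ (1 / N) * ‖A x‖ ^ 2 := by
    calc _ ≤ (1 / N) ^ 2 * (N * ‖A x‖ ^ 2) := by gcongr
      _ = _ := by field_simp
  have h5 : (1 / N) * ‖A x‖ ^ 2 ≤ ⟪A x, x⟫_ℝ := by linarith
  calc ‖A x‖ ^ 2 = N * ((1 / N) * ‖A x‖ ^ 2) := by field_simp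
    _ ≤ _ := by gcongr

theorem mnorm_sq {M : H →L[ℝ] H} {x : H} (h : 0 ≤ ⟪M x, x⟫_ℝ) :
    mnorm M x ^ 2 = ⟪M x, x⟫_ℝ := Real.sq_sqrt h

theorem mnorm_nonneg (M : H →L[ℝ] H) (x : H) : 0 ≤ mnorm M x := Real.sqrt_nonneg _

theorem mnorm_smul (M : H →L[ℝ] H) {a : ℝ} (ha : 0 ≤ a) (x : H) :
    mnorm M (a • x) = a * mnorm M x := by
  unfold mnorm
  rw [map_smul, real_inner_smul_left, real_inner_smul_right, ← mul_assoc,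
    Real.sqrt_mul (by positivity), Real.sqrt_mul_self ha]

theorem inner_add_self {M : H →L[ℝ] H} (hs : ∀ x y, ⟪M x, y⟫_ℝ = ⟪M y, x⟫_ℝ) (x y : H) :
    ⟪M (x + y), x + y⟫_ℝ = ⟪M x, x⟫_ℝ + 2 * ⟪M x, y⟫_ℝ + ⟪M y, y⟫_ℝ := by
  rw [map_add]
  simp only [inner_add_left, inner_add_right]
  rw [hs y x]
  ring

theorem mnorm_add_le {M : H →L[ℝ] H} (hs : ∀ x y, ⟪M x, y⟫_ℝ = ⟪M y, x⟫_ℝ)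
    (hp : ∀ x, 0 ≤ ⟪M x, x⟫_ℝ) (x y : H) : mnorm M (x + y) ≤ mnorm M x + mnorm M y := by
  have hx := mnorm_nonneg M x
  have hy := mnorm_nonneg M y
  refine abs_le_of_sq_le_sq' ?_ (by positivity) |>.2
  rw [mnorm_sq (hp _), inner_add_self hs]
  -- Cauchy–Schwarz for the form of `M`: the quadratic `t ↦ ⟪M (x + t y), x + t y⟫` is nonnegative.
  have hdisc : discrim ⟪M y, y⟫_ℝ (2 * ⟪M x, y⟫_ℝ) ⟪M x, x⟫_ℝ ≤ 0 := by
    refine discrim_le_zero fun t => ?_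
    have h := hp (x + t • y)
    rw [inner_add_self hs, map_smul, real_inner_smul_right, real_inner_smul_left,
      real_inner_smul_right] at h
    linarith
  have h1 : ⟪M x, y⟫_ℝ ≤ mnorm M x * mnorm M y := by
    refine abs_le_of_sq_le_sq' ?_ (by positivity) |>.2
    rw [mul_pow, mnorm_sq (hp _), mnorm_sq (hp _)]
    unfold discrim at hdisc
    linarith
  nlinarith [mnorm_sq (hp x), mnorm_sq (hp y)]

theorem mnorm_le {M : H →L[ℝ] H} {N : ℝ} (hN : ‖M‖ ≤ N) (x : H) : mnorm M x ≤ √N * ‖x‖ := by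
  have h0 : 0 ≤ N := (norm_nonneg _).trans hN
  unfold mnorm
  rw [← Real.sqrt_sq (norm_nonneg x), ← Real.sqrt_mul h0]
  exact Real.sqrt_le_sqrt ((inner_apply_self_le M x).trans (by gcongr))

end Metric

/-! ### Weak limits and Opial's lemma. -/

section Weak

/-- A point outside a closed convex set is strictly separated from it by a functional, which
contradicts weak convergence (Mazur). -/
theorem mem_of_weak_limit {ι : Type*} {l : Filter ι} [l.NeBot] {z : ι → H} {p : H} {C : Set H}
    (hC : Convex ℝ C) (hcl : IsClosed C) (hz : ∀ᶠ k in l, z k ∈ C)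
    (hp : ∀ φ : StrongDual ℝ H, Tendsto (fun k => φ (z k)) l (𝓝 (φ p))) : p ∈ C := by
  by_contra hpC
  obtain ⟨φ, u, h1, h2⟩ := geometric_hahn_banach_closed_point hC hcl hpC
  exact absurd (le_of_tendsto (hp φ) (hz.mono fun k hk => (h1 _ hk).le)) (not_le.2 h2)

variable [CompleteSpace H]

/-- A bounded sequence in a Hilbert space has a weak limit along every ultrafilter. -/
theorem exists_weak_limit {ι : Type*} (u : Ultrafilter ι) {z : ι → H} {R : ℝ} (hR : ∀ k, ‖z k‖ ≤ R) :
    ∃ p : H, ∀ φ : StrongDual ℝ H, Tendsto (fun k => φ (z k)) u (𝓝 (φ p)) := by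
  have hc := WeakDual.isCompact_closedBall (𝕜 := ℝ) (E := H) 0 R
  let F : ι → WeakDual ℝ H := fun k => StrongDual.toWeakDual (InnerProductSpace.toDual ℝ H (z k))
  obtain ⟨ψ, -, hψ⟩ := hc.ultrafilter_le_nhds (u.map F) (by
    rw [le_principal_iff]
    exact Filter.mem_map.2 (Filter.mem_of_superset univ_mem fun k _ => by simpa [F] using hR k))
  have hψ' : Tendsto F u (𝓝 ψ) := hψ
  rw [tendsto_iff_forall_eval_tendsto_topDualPairing] at hψ'
  refine ⟨(InnerProductSpace.toDual ℝ H).symm (WeakDual.toStrongDual ψ), fun φ => ?_⟩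
  have h1 := hψ' ((InnerProductSpace.toDual ℝ H).symm φ)
  have h2 : ∀ x : H, φ x = ⟪x, (InnerProductSpace.toDual ℝ H).symm φ⟫_ℝ := fun x => by
    rw [real_inner_comm, InnerProductSpace.toDual_symm_apply]
  rw [h2, InnerProductSpace.toDual_symm_apply]
  refine h1.congr fun k => ?_
  rw [h2]
  rfl

/-- Metrics that are almost decreasing converge pointwise. -/
theorem exists_tendsto_metric {M : ℕ → H →L[ℝ] H} {σ : ℝ} (hσ : 0 ≤ σ) (hM : ∀ k, InS σ (M k))
    (hb : BddAbove (Set.range fun k => ‖M k‖)) {η : ℕ → ℝ} (hη : ∀ k, 0 ≤ η k) (hs : Summable η)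
    (hmono : ∀ k x, ⟪M (k + 1) x, x⟫_ℝ ≤ (1 + η k) * ⟪M k x, x⟫_ℝ) (x : H) :
    ∃ m, Tendsto (fun k => M k x) atTop (𝓝 m) := by
  obtain ⟨N, hN⟩ := hb
  have hN : ∀ k, ‖M k‖ ≤ N := fun k => hN ⟨k, rfl⟩
  obtain ⟨c, hc⟩ := exists_tendsto_prod_one_add hη hs
  set P : ℕ → ℝ := fun n => ∏ j ∈ Finset.range n, (1 + η j) with hP
  have hP1 : ∀ n, 1 ≤ P n := one_le_prod_one_add hη
  have hP0 : ∀ n, 0 < P n := fun n => by linarith [hP1 n]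
  -- Normalising by the products makes the quadratic forms genuinely decreasing.
  let A : ℕ → H →L[ℝ] H := fun k => (P k)⁻¹ • M k
  have hAsymm : ∀ k x y, ⟪A k x, y⟫_ℝ = ⟪A k y, x⟫_ℝ := fun k x y => by
    simp only [A, smul_apply, real_inner_smul_left]
    rw [inner_apply_comm (hM k).1]
  have hAanti : ∀ x, Antitone fun k => ⟪A k x, x⟫_ℝ := fun x => by
    refine antitone_nat_of_succ_le fun n => ?_
    have h1 : P (n + 1) = P n * (1 + η n) := Finset.prod_range_succ _ _
    have h3 : 0 < 1 + η n := by linarith [hη n]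
    simp only [A, smul_apply, real_inner_smul_left]
    rw [h1]
    have := hP0 n
    calc (P n * (1 + η n))⁻¹ * ⟪M (n + 1) x, x⟫_ℝ
        ≤ (P n * (1 + η n))⁻¹ * ((1 + η n) * ⟪M n x, x⟫_ℝ) := by gcongr; exact hmono n x
      _ = _ := by field_simp
  have hA0 : ∀ k x, 0 ≤ ⟪A k x, x⟫_ℝ := fun k x => by
    simp only [A, smul_apply, real_inner_smul_left]
    exact mul_nonneg (inv_nonneg.2 (hP0 k).le) ((hM k).pos hσ x)
  have hAN : ∀ k, ‖A k‖ ≤ N := fun k => by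
    simp only [A]
    rw [norm_smul, Real.norm_of_nonneg (inv_nonneg.2 (hP0 k).le)]
    exact (mul_le_of_le_one_left (norm_nonneg _) (inv_le_one_of_one_le₀ (hP1 k))).trans (hN k)
  have hN0 : 0 ≤ N := (norm_nonneg _).trans (hN 0)
  have hlim := tendsto_atTop_ciInf (hAanti x) ⟨0, by rintro _ ⟨n, rfl⟩; exact hA0 n x⟩
  have hcau : CauchySeq fun k => A k x := by
    have hl := hlim.cauchySeq
    rw [Metric.cauchySeq_iff'] at hl ⊢
    intro δ hδ
    obtain ⟨n, hn⟩ := hl (δ ^ 2 / (2 * N + 1)) (by positivity)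
    refine ⟨n, fun m hm => ?_⟩
    have h1 := hn m hm
    have h2 := hAanti x hm
    rw [Real.dist_eq, abs_of_nonpos (by simpa using h2)] at h1
    -- `A n - A m` is positive, so its value at `x` is controlled by the difference of the
    -- convergent quadratic forms; the `+ 1` only makes the norm bound strictly positive.
    have h3 := norm_apply_sq_le_of_pos (A := A n - A m) (N := 2 * N + 1)
      (fun x y => by
        simp only [sub_apply, inner_sub_left]; rw [hAsymm, hAsymm m])
      (fun x => by
        simp only [sub_apply, inner_sub_left]
        linarith [hAanti x hm]) (by positivity)
      ((norm_sub_le _ _).trans (by linarith [hAN n, hAN m])) x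
    rw [sub_apply, inner_sub_left] at h3
    rw [dist_comm, dist_eq_norm]
    refine lt_of_pow_lt_pow_left₀ 2 hδ.le (h3.trans_lt ?_)
    rw [lt_div_iff₀ (by positivity)] at h1
    linarith
  obtain ⟨m, hm⟩ := cauchySeq_tendsto_of_complete hcau
  refine ⟨c • m, (hc.smul hm).congr fun k => ?_⟩
  simp only [A, smul_apply]
  rw [smul_inv_smul₀ (hP0 k).ne']

/-- Opial's lemma for variable metrics. -/
theorem exists_weaklyTendsto {M : ℕ → H →L[ℝ] H} {σ : ℝ} (hσ : 0 < σ) (hM : ∀ k, InS σ (M k))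
    (hlim : ∀ x, ∃ m, Tendsto (fun k => M k x) atTop (𝓝 m)) {z : ℕ → H} {Z : Set H}
    (hZ : Z.Nonempty)
    (hdist : ∀ p ∈ Z, ∃ l, Tendsto (fun k => ⟪M k (z k - p), z k - p⟫_ℝ) atTop (𝓝 l))
    (hclus : ∀ u : Ultrafilter ℕ, (u : Filter ℕ) ≤ atTop → ∀ p,
      (∀ φ : StrongDual ℝ H, Tendsto (fun k => φ (z k)) u (𝓝 (φ p))) → p ∈ Z) :
    ∃ p ∈ Z, WeaklyTendsto z p := by
  have hbdd : ∃ R, ∀ k, ‖z k‖ ≤ R := by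
    obtain ⟨p, hp⟩ := hZ
    obtain ⟨l, hl⟩ := hdist p hp
    obtain ⟨R, hR⟩ := hl.bddAbove_range
    refine ⟨√(R / σ) + ‖p‖, fun k => ?_⟩
    have h1 : ‖z k - p‖ ≤ √(R / σ) := by
      apply Real.le_sqrt_of_sq_le
      rw [le_div_iff₀ hσ, mul_comm]
      exact ((hM k).2 _).trans (hR ⟨k, rfl⟩)
    have := norm_add_le (z k - p) p
    rw [sub_add_cancel] at this
    linarith
  obtain ⟨R, hR⟩ := hbdd
  have huniq : ∀ u v : Ultrafilter ℕ, (u : Filter ℕ) ≤ atTop → (v : Filter ℕ) ≤ atTop → ∀ p q,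
      (∀ φ : StrongDual ℝ H, Tendsto (fun k => φ (z k)) u (𝓝 (φ p))) →
      (∀ φ : StrongDual ℝ H, Tendsto (fun k => φ (z k)) v (𝓝 (φ q))) → p = q := by
    intro u v hu hv p q hp hq
    obtain ⟨lp, hlp⟩ := hdist p (hclus u hu p hp)
    obtain ⟨lq, hlq⟩ := hdist q (hclus v hv q hq)
    obtain ⟨m, hm⟩ := hlim (p - q)
    obtain ⟨mp, hmp⟩ := hlim p
    obtain ⟨mq, hmq⟩ := hlim q
    -- The terms quadratic in `z k` cancel in the difference of the two squared distances, so the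
    -- pairing of `z k` with `M k (p - q)` converges along the whole sequence.
    have hMz : Tendsto (fun k => ⟪M k (p - q), z k⟫_ℝ) atTop
        (𝓝 ((lq - lp + ⟪mp, p⟫_ℝ - ⟪mq, q⟫_ℝ) / 2)) := by
      refine ((((hlq.sub hlp).add (hmp.inner tendsto_const_nhds)).sub
        (hmq.inner tendsto_const_nhds)).div_const 2).congr fun k => ?_
      simp only [map_sub, inner_sub_left, inner_sub_right]
      rw [inner_apply_comm (hM k).1 (z k) p, inner_apply_comm (hM k).1 (z k) q]
      ring
    -- Boundedness of `z` allows `M k (p - q)` to be replaced by its strong limit `m`; evaluating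
    -- along both ultrafilters then gives `⟪m, p⟫ = ⟪m, q⟫`.
    have hmz : Tendsto (fun k => ⟪m, z k⟫_ℝ) atTop
        (𝓝 ((lq - lp + ⟪mp, p⟫_ℝ - ⟪mq, q⟫_ℝ) / 2)) := by
      have h0 : Tendsto (fun k => ⟪M k (p - q) - m, z k⟫_ℝ) atTop (𝓝 0) := by
        have h1 : Tendsto (fun k => ‖M k (p - q) - m‖ * R) atTop (𝓝 0) := by
          simpa using (tendsto_iff_norm_sub_tendsto_zero.1 hm).mul_const R
        refine squeeze_zero_norm (fun k => ?_) h1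
        exact (norm_inner_le_norm _ _).trans (by gcongr; exact hR k)
      have := hMz.sub h0
      rw [sub_zero] at this
      refine this.congr fun k => ?_
      rw [inner_sub_left]; ring
    have e1 := tendsto_nhds_unique (hmz.mono_left hu) (hp (InnerProductSpace.toDual ℝ H m))
    have e2 := tendsto_nhds_unique (hmz.mono_left hv) (hq (InnerProductSpace.toDual ℝ H m))
    simp only [InnerProductSpace.toDual_apply_apply] at e1 e2
    have e3 : ⟪m, p - q⟫_ℝ = 0 := by rw [inner_sub_right]; linarith
    have e4 : σ * ‖p - q‖ ^ 2 ≤ ⟪m, p - q⟫_ℝ :=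
      ge_of_tendsto' (hm.inner tendsto_const_nhds) fun k => (hM k).2 _
    have e5 : ‖p - q‖ ^ 2 ≤ 0 := by
      rw [e3] at e4
      by_contra hcon
      push Not at hcon
      linarith [mul_pos hσ hcon]
    exact sub_eq_zero.1 (norm_eq_zero.1 (pow_eq_zero_iff two_ne_zero |>.1
      (le_antisymm e5 (sq_nonneg _))))
  -- Any ultrafilter finer than `atTop` supplies a candidate; by uniqueness all the others have the
  -- same weak limit.
  obtain ⟨p, hp⟩ := exists_weak_limit (hyperfilter ℕ) hR
  have hle : (hyperfilter ℕ : Filter ℕ) ≤ atTop := by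
    rw [← Nat.cofinite_eq_atTop]; exact hyperfilter_le_cofinite
  refine ⟨p, hclus _ hle p hp, ?_⟩
  have key : ∀ φ : StrongDual ℝ H, Tendsto (fun k => φ (z k)) atTop (𝓝 (φ p)) := by
    intro φ
    rw [tendsto_iff_ultrafilter]
    intro v hv
    obtain ⟨q, hq⟩ := exists_weak_limit v hR
    rw [huniq _ v hle hv p q hp hq]
    exact hq φ
  exact (WeakBilin.tendsto_iff_forall_eval_tendsto _
    (fun x y hxy => by
      refine sub_eq_zero.1 (inner_self_eq_zero (𝕜 := ℝ).1 ?_)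
      have := LinearMap.congr_fun hxy (InnerProductSpace.toDual ℝ H (x - y))
      change ⟪x - y, x⟫_ℝ = ⟪x - y, y⟫_ℝ at this
      rw [inner_sub_right, this, sub_self])).2 key

end Weak

end QNPDHG

/-! ### Subgradients, gradients and proximal maps. -/

namespace QNPDHG

/-- Divide by `t` and let `t` decrease to `0`. The form `B * (1 - t)` matches the term `t (1 - t)`
of strong convexity, so that no part of the modulus is lost in the limit. -/
theorem le_of_hasDerivAt_of_slope {φ : ℝ → ℝ} {φ' A B : ℝ} (h : HasDerivAt φ φ' 0)
    (hle : ∀ t, 0 < t → t < 1 → t * (A + B * (1 - t)) ≤ φ t - φ 0) : A + B ≤ φ' := by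
  have h1 := (hasDerivAt_iff_tendsto_slope_zero.1 h).mono_left
    (nhdsWithin_mono 0 (fun t (ht : 0 < t) => ne_of_gt ht) : 𝓝[>] (0 : ℝ) ≤ 𝓝[≠] 0)
  have h2 : Tendsto (fun t : ℝ => A + B * (1 - t)) (𝓝[>] 0) (𝓝 (A + B)) := by
    have : Continuous fun t : ℝ => A + B * (1 - t) := by fun_prop
    simpa using (this.tendsto 0).mono_left nhdsWithin_le_nhds
  refine le_of_tendsto_of_tendsto h2 h1 ?_
  filter_upwards [Ioo_mem_nhdsGT (zero_lt_one' ℝ)] with t ht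
  have := hle t ht.1 ht.2
  rw [zero_add, smul_eq_mul, inv_mul_eq_div, le_div_iff₀ ht.1]
  linarith

theorem ereal_add_coe_le {a : EReal} (ha : a ≠ ⊥) {r s : ℝ} (h : a + (r : EReal) ≤ (s : EReal)) :
    a ≠ ⊤ ∧ a.toReal + r ≤ s := by
  induction a with
  | bot => exact absurd rfl ha
  | top => rw [EReal.top_add_coe] at h; exact absurd (top_le_iff.1 h) (EReal.coe_ne_top s)
  | coe a => exact ⟨EReal.coe_ne_top a, by rw [EReal.toReal_coe]; exact_mod_cast h⟩

variable {H : Type*} [NormedAddCommGroup H] [InnerProductSpace ℝ H]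

/-- `w` is a subgradient of `g` at `p`, with quadratic growth of modulus `μ`. -/
def IsSub (μ : ℝ) (g : H → EReal) (p w : H) : Prop :=
  g p ≠ ⊤ ∧ ∀ v, g v ≠ ⊤ →
    (g p).toReal + ⟪w, v - p⟫_ℝ + μ / 2 * ‖v - p‖ ^ 2 ≤ (g v).toReal

/-- Add the two subgradient inequalities; each contributes `μ / 2`. -/
theorem IsSub.inner_le {μ : ℝ} {g : H → EReal} {p q w w' : H} (h : IsSub μ g p w)
    (h' : IsSub μ g q w') : μ * ‖p - q‖ ^ 2 ≤ ⟪w - w', p - q⟫_ℝ := by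
  have h1 := h.2 q h'.1
  have h2 := h'.2 p h.1
  rw [norm_sub_rev q p, ← neg_sub p q, inner_neg_right] at h1
  rw [inner_sub_left]
  linarith

theorem ConvexWithModulus.toReal_le {μ : ℝ} {g : H → EReal} (hg : ConvexWithModulus μ g)
    (hb : ∀ x, g x ≠ ⊥) {x y : H} (hx : g x ≠ ⊤) (hy : g y ≠ ⊤) {a b : ℝ} (ha : 0 < a) (hb' : 0 < b)
    (hab : a + b = 1) : g (a • x + b • y) ≠ ⊤ ∧
      (g (a • x + b • y)).toReal + μ / 2 * a * b * ‖x - y‖ ^ 2 ≤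
        a * (g x).toReal + b * (g y).toReal := by
  have h := hg x y a b ha hb' hab
  rw [← EReal.coe_toReal hx (hb x), ← EReal.coe_toReal hy (hb y)] at h
  exact ereal_add_coe_le (hb _) (by exact_mod_cast h)

/-- First order optimality condition for the sum of a convex function and a function with
directional derivatives. -/
theorem isSub_of_minimizer {μ : ℝ} {g : H → EReal} (hb : ∀ x, g x ≠ ⊥) (htop : ∃ x, g x ≠ ⊤)
    (hg : ConvexWithModulus μ g) {h : H → ℝ} {p w : H}
    (hmin : ∀ v, g p + (h p : EReal) ≤ g v + (h v : EReal))
    (hder : ∀ d, HasDerivAt (fun t : ℝ => h (p + t • d)) (-⟪w, d⟫_ℝ) 0) : IsSub μ g p w := by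
  have hreal : ∀ v, g v ≠ ⊤ → g p ≠ ⊤ ∧ (g p).toReal + h p ≤ (g v).toReal + h v := fun v hv => by
    have := hmin v
    rw [← EReal.coe_toReal hv (hb v)] at this
    exact ereal_add_coe_le (hb _) (by exact_mod_cast this)
  obtain ⟨v₀, hv₀⟩ := htop
  have hp := (hreal v₀ hv₀).1
  refine ⟨hp, fun v hv => ?_⟩
  have := le_of_hasDerivAt_of_slope (hder (v - p)) (A := (g p).toReal - (g v).toReal)
    (B := μ / 2 * ‖v - p‖ ^ 2) fun t ht0 ht1 => by
      obtain ⟨h1, h2⟩ := hg.toReal_le hb hp hv (sub_pos.2 ht1) ht0 (sub_add_cancel 1 t)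
      have h3 := (hreal _ h1).2
      have h4 : p + t • (v - p) = (1 - t) • p + t • v := by module
      rw [h4, zero_smul, add_zero]
      rw [norm_sub_rev] at h2
      linarith
  linarith

section Smooth

variable [CompleteSpace H]

theorem hasDerivAt_comp_line {G : H → ℝ} (hG : Differentiable ℝ G) (p d : H) (t : ℝ) :
    HasDerivAt (fun t : ℝ => G (p + t • d)) ⟪gradient G (p + t • d), d⟫_ℝ t := by
  have h1 := (hG (p + t • d)).hasGradientAt.hasFDerivAt
  have h2 : HasDerivAt (fun t : ℝ => p + t • d) d t := by
    simpa using ((hasDerivAt_id t).smul_const d).const_add p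
  exact (h1.comp_hasDerivAt t h2).congr_deriv (by simp)

theorem gradient_inequality {G : H → ℝ} (hG : Differentiable ℝ G) {m : ℝ}
    (hc : StrongConvexOn Set.univ m G) (p v : H) :
    G p + ⟪gradient G p, v - p⟫_ℝ + m / 2 * ‖v - p‖ ^ 2 ≤ G v := by
  have h0 := (hasDerivAt_comp_line hG p (v - p) 0).neg
  rw [zero_smul, add_zero] at h0
  have := le_of_hasDerivAt_of_slope h0 (A := G p - G v)
    (B := m / 2 * ‖v - p‖ ^ 2) fun t ht0 ht1 => by
      have h2 := hc.2 (Set.mem_univ p) (Set.mem_univ v) (sub_pos.2 ht1).le ht0.le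
        (sub_add_cancel 1 t)
      have h4 : p + t • (v - p) = (1 - t) • p + t • v := by module
      simp only [Pi.neg_apply]
      rw [h4, zero_smul, add_zero]
      rw [norm_sub_rev] at h2
      simp only [smul_eq_mul] at h2
      linarith
  linarith

theorem gradient_stronglyMonotone {G : H → ℝ} (hG : Differentiable ℝ G) {m : ℝ}
    (hc : StrongConvexOn Set.univ m G) (x y : H) :
    m * ‖x - y‖ ^ 2 ≤ ⟪gradient G x - gradient G y, x - y⟫_ℝ := by
  have h1 := gradient_inequality hG hc x y
  have h2 := gradient_inequality hG hc y x
  rw [norm_sub_rev y x, ← neg_sub x y, inner_neg_right] at h1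
  rw [inner_sub_left]
  linarith

/-- The descent lemma for functions with Lipschitz gradient. -/
theorem descent_lemma {G : H → ℝ} (hG : Differentiable ℝ G) {L : ℝ}
    (hL : ∀ x y, ‖gradient G x - gradient G y‖ ≤ L * ‖x - y‖) (y d : H) :
    G (y + d) ≤ G y + ⟪gradient G y, d⟫_ℝ + L / 2 * ‖d‖ ^ 2 := by
  let φ : ℝ → ℝ := fun t => G (y + t • d) - t * ⟪gradient G y, d⟫_ℝ - L / 2 * ‖d‖ ^ 2 * t ^ 2
  -- By the Lipschitz bound this derivative is nonpositive on `[0, 1]`; comparing the endpoints of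
  -- the interval gives the claim.
  have hφ : ∀ t, HasDerivAt φ
      (⟪gradient G (y + t • d), d⟫_ℝ - ⟪gradient G y, d⟫_ℝ - L * ‖d‖ ^ 2 * t) t := fun t => by
    have := ((hasDerivAt_comp_line hG y d t).sub
      ((hasDerivAt_id t).mul_const ⟪gradient G y, d⟫_ℝ)).sub
      ((hasDerivAt_pow 2 t).const_mul (L / 2 * ‖d‖ ^ 2))
    exact this.congr_deriv (by simp; ring)
  have hanti : AntitoneOn φ (Set.Icc 0 1) := by
    refine antitoneOn_of_deriv_nonpos (convex_Icc 0 1)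
      (fun t _ => (hφ t).continuousAt.continuousWithinAt)
      (fun t _ => (hφ t).differentiableAt.differentiableWithinAt) fun t ht => ?_
    rw [interior_Icc] at ht
    rw [(hφ t).deriv, ← inner_sub_left]
    have h1 := real_inner_le_norm (gradient G (y + t • d) - gradient G y) d
    have h2 := hL (y + t • d) y
    rw [add_sub_cancel_left, norm_smul, Real.norm_of_nonneg ht.1.le] at h2
    have h3 := mul_le_mul_of_nonneg_right h2 (norm_nonneg d)
    linarith
  have := hanti (Set.left_mem_Icc.2 zero_le_one) (Set.right_mem_Icc.2 zero_le_one) zero_le_one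
  simp only [φ, one_smul, zero_smul, add_zero] at this
  linarith

/-- The Baillon–Haddad theorem. -/
theorem gradient_cocoercive {G : H → ℝ} (hG : Differentiable ℝ G) (hc : ConvexOn ℝ Set.univ G)
    {β : ℝ} (hβ : 0 < β) (hL : ∀ x y, ‖gradient G x - gradient G y‖ ≤ 1 / β * ‖x - y‖) (x y : H) :
    β * ‖gradient G x - gradient G y‖ ^ 2 ≤ ⟪gradient G x - gradient G y, x - y⟫_ℝ := by
  -- Compare two bounds at `y - β e`: the descent lemma from `y` above and the tangent at `x` below.
  -- The step length `β` is the minimiser of the quadratic upper bound. Adding the inequality to its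
  -- version with `x` and `y` exchanged gives cocoercivity.
  have key : ∀ x y, G x + ⟪gradient G x, y - x⟫_ℝ +
      β / 2 * ‖gradient G y - gradient G x‖ ^ 2 ≤ G y := fun x y => by
    set e := gradient G y - gradient G x with he
    have h1 := descent_lemma hG hL y (-(β • e))
    have h2 := gradient_inequality hG (strongConvexOn_zero.2 hc) x (y + -(β • e))
    have h3 : y + -(β • e) - x = (y - x) + -(β • e) := by abel
    have h4 : ⟪gradient G y, e⟫_ℝ - ⟪gradient G x, e⟫_ℝ = ‖e‖ ^ 2 := by
      rw [← inner_sub_left, ← he, real_inner_self_eq_norm_sq]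
    rw [h3, inner_add_right, inner_neg_right, real_inner_smul_right] at h2
    rw [inner_neg_right, real_inner_smul_right, norm_neg, norm_smul,
      Real.norm_of_nonneg hβ.le] at h1
    have h5 : 1 / β / 2 * (β * ‖e‖) ^ 2 = β / 2 * ‖e‖ ^ 2 := by field_simp
    have h6 : β * ⟪gradient G y, e⟫_ℝ = β * ‖e‖ ^ 2 + β * ⟪gradient G x, e⟫_ℝ := by
      rw [← h4]; ring
    linarith
  have h1 := key x y
  have h2 := key y x
  rw [norm_sub_rev, ← neg_sub x y, inner_neg_right] at h1
  rw [inner_sub_left]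
  linarith

theorem SmoothConvex.differentiable {L : ℝ} {G : H → ℝ} (hG : SmoothConvex L G) :
    Differentiable ℝ G := hG.contDiff.differentiable one_ne_zero

end Smooth

section Prox

variable [CompleteSpace H]

theorem IsStepOperator.symm_comm {T : H ≃L[ℝ] H} (hT : IsStepOperator T) (x y : H) :
    ⟪T.symm x, y⟫_ℝ = ⟪T.symm y, x⟫_ℝ := by
  have h : IsSelfAdjoint (T : H →L[ℝ] H) := ContinuousLinearMap.IsPositive.isSelfAdjoint hT
  have := inner_apply_comm h (T.symm x) (T.symm y)
  simp only [ContinuousLinearEquiv.coe_coe, ContinuousLinearEquiv.apply_symm_apply] at this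
  rw [real_inner_comm, ← this, real_inner_comm]

/-- This is `‖T y‖² ≤ N ⟪T y, y⟫` at `y = T⁻¹ x`; it makes the quadratic form of `T⁻¹` coercive. -/
theorem IsStepOperator.norm_sq_le {T : H ≃L[ℝ] H} (hT : IsStepOperator T) (x : H) :
    ‖x‖ ^ 2 ≤ (‖(T : H →L[ℝ] H)‖ + 1) * ⟪T.symm x, x⟫_ℝ := by
  have h : IsSelfAdjoint (T : H →L[ℝ] H) := ContinuousLinearMap.IsPositive.isSelfAdjoint hT
  have hp : ∀ x, 0 ≤ ⟪(T : H →L[ℝ] H) x, x⟫_ℝ := fun x => hT.inner_nonneg_left x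
  have := norm_apply_sq_le_of_pos (inner_apply_comm h) hp
    (N := ‖(T : H →L[ℝ] H)‖ + 1) (by positivity) (by linarith) (T.symm x)
  simpa [real_inner_comm] using this

/-- The first order condition at the minimiser: the quadratic term has gradient `T⁻¹ (p - u)` there.
The modulus `μ` is kept for use in the linear rates. -/
theorem IsProx.isSub {T : H ≃L[ℝ] H} (hT : IsStepOperator T) {g : H → EReal} {μ : ℝ}
    (hg : ProperConvexLSC g) (hμ : ConvexWithModulus μ g) {u p : H} (hp : IsProx T g u p) :
    IsSub μ g p (T.symm (u - p)) := by
  refine isSub_of_minimizer hg.ne_bot hg.exists_ne_top hμ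
    (h := fun v => 1 / 2 * ⟪T.symm (v - u), v - u⟫_ℝ) hp fun d => ?_
  have h1 : (fun t : ℝ => 1 / 2 * ⟪T.symm (p + t • d - u), p + t • d - u⟫_ℝ) = fun t : ℝ =>
      1 / 2 * ⟪T.symm (p - u), p - u⟫_ℝ + t * ⟪T.symm (p - u), d⟫_ℝ +
        1 / 2 * ⟪T.symm d, d⟫_ℝ * t ^ 2 := by
    funext t
    have : p + t • d - u = (p - u) + t • d := by abel
    rw [this, map_add, map_smul]
    simp only [inner_add_left, inner_add_right, real_inner_smul_left, real_inner_smul_right]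
    rw [hT.symm_comm d (p - u)]
    ring
  rw [h1]
  have h2 := (((hasDerivAt_id (0 : ℝ)).mul_const ⟪T.symm (p - u), d⟫_ℝ).const_add
    (1 / 2 * ⟪T.symm (p - u), p - u⟫_ℝ)).add
    ((hasDerivAt_pow 2 (0 : ℝ)).const_mul (1 / 2 * ⟪T.symm d, d⟫_ℝ))
  refine h2.congr_deriv ?_
  rw [← neg_sub p u, map_neg, inner_neg_left]
  simp

/-- Nonexpansiveness of the proximal map in the metric `T⁻¹`. -/
theorem IsProx.inner_le {T : H ≃L[ℝ] H} (hT : IsStepOperator T) {g : H → EReal}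
    (hg : ProperConvexLSC g) {u u' p p' : H} (hp : IsProx T g u p) (hp' : IsProx T g u' p') :
    ‖p - p'‖ ^ 2 ≤ (‖(T : H →L[ℝ] H)‖ + 1) * ⟪T.symm (u - u'), p - p'⟫_ℝ := by
  have h1 := (hp.isSub hT hg hg.convex).inner_le (hp'.isSub hT hg hg.convex)
  have h2 := hT.norm_sq_le (p - p')
  refine h2.trans ?_
  gcongr
  have h3 : T.symm (u - p) - T.symm (u' - p') = T.symm (u - u') - T.symm (p - p') := by
    simp only [map_sub]; abel
  rw [h3, inner_sub_left] at h1
  linarith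

theorem IsProx.unique {T : H ≃L[ℝ] H} (hT : IsStepOperator T) {g : H → EReal}
    (hg : ProperConvexLSC g) {u p p' : H} (hp : IsProx T g u p) (hp' : IsProx T g u p') :
    p = p' := by
  have := hp.inner_le hT hg hp'
  rw [sub_self, map_zero, inner_zero_left, mul_zero] at this
  exact sub_eq_zero.1 (norm_eq_zero.1 (pow_eq_zero_iff two_ne_zero |>.1
    (le_antisymm this (sq_nonneg _))))

end Prox

end QNPDHG

/-! ### Saddle points and the primal-dual operator on the product space. -/

namespace QNPDHG

variable {H₁ H₂ : Type*} [NormedAddCommGroup H₁] [NormedAddCommGroup H₂]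

theorem pd_norm_sq (x : PD H₁ H₂) :
    ‖x‖ ^ 2 = ‖x.fst‖ ^ 2 + ‖x.snd‖ ^ 2 :=
  WithLp.prod_norm_sq_eq_of_L2 x

theorem pd_norm_le (x : PD H₁ H₂) : ‖x‖ ≤ ‖x.fst‖ + ‖x.snd‖ := by
  refine abs_le_of_sq_le_sq' ?_ (by positivity) |>.2
  rw [pd_norm_sq]
  nlinarith [norm_nonneg x.fst, norm_nonneg x.snd]

theorem pd_norm_fst_le (x : PD H₁ H₂) : ‖x.fst‖ ≤ ‖x‖ := by
  refine abs_le_of_sq_le_sq' ?_ (by positivity) |>.2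
  rw [pd_norm_sq]
  nlinarith [norm_nonneg x.fst, norm_nonneg x.snd]

theorem pd_norm_snd_le (x : PD H₁ H₂) : ‖x.snd‖ ≤ ‖x‖ := by
  refine abs_le_of_sq_le_sq' ?_ (by positivity) |>.2
  rw [pd_norm_sq]
  nlinarith [norm_nonneg x.fst, norm_nonneg x.snd]

variable [InnerProductSpace ℝ H₁] [InnerProductSpace ℝ H₂]

theorem pd_inner (x y : PD H₁ H₂) : ⟪x, y⟫_ℝ = ⟪x.fst, y.fst⟫_ℝ + ⟪x.snd, y.snd⟫_ℝ :=
  WithLp.prod_inner_apply x y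

section Sublevel

theorem ereal_add_le_iff {a b : EReal} (ha : a ≠ ⊥) (hb : b ≠ ⊥) {c : ℝ} :
    a + b ≤ (c : EReal) ↔ a ≠ ⊤ ∧ b ≠ ⊤ ∧ a.toReal + b.toReal ≤ c := by
  constructor
  · intro h
    have hb' : b ≠ ⊤ := by
      rintro rfl
      rw [EReal.add_top_of_ne_bot ha] at h
      exact EReal.coe_ne_top c (top_le_iff.1 h)
    rw [← EReal.coe_toReal hb' hb] at h
    obtain ⟨h1, h2⟩ := ereal_add_coe_le ha h
    exact ⟨h1, hb', h2⟩
  · rintro ⟨h1, h2, h3⟩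
    rw [← EReal.coe_toReal h1 ha, ← EReal.coe_toReal h2 hb]
    exact_mod_cast h3

variable {g : H₁ → EReal} {f : H₂ → EReal}

theorem isClosed_sublevel (hg : ProperConvexLSC g) (hf : ProperConvexLSC f) (c : ℝ) :
    IsClosed {z : PD H₁ H₂ | g z.fst + f z.snd ≤ (c : EReal)} := by
  have h1 : LowerSemicontinuous fun z : PD H₁ H₂ => g z.fst :=
    hg.lsc.comp (WithLp.prod_continuous_ofLp 2 H₁ H₂).fst
  have h2 : LowerSemicontinuous fun z : PD H₁ H₂ => f z.snd :=
    hf.lsc.comp (WithLp.prod_continuous_ofLp 2 H₁ H₂).snd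
  have h3 : LowerSemicontinuous fun z : PD H₁ H₂ => g z.fst + f z.snd :=
    h1.add' h2 fun z => EReal.continuousAt_add (Or.inr (hf.ne_bot _)) (Or.inl (hg.ne_bot _))
  exact h3.isClosed_preimage (c : EReal)

theorem convex_sublevel (hg : ProperConvexLSC g) (hf : ProperConvexLSC f) (c : ℝ) :
    Convex ℝ {z : PD H₁ H₂ | g z.fst + f z.snd ≤ (c : EReal)} := by
  rw [convex_iff_forall_pos]
  intro z hz w hw a b ha hb hab
  rw [Set.mem_ofPred_eq, ereal_add_le_iff (hg.ne_bot _) (hf.ne_bot _)] at hz hw ⊢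
  obtain ⟨h1, h2⟩ := hg.convex.toReal_le hg.ne_bot hz.1 hw.1 ha hb hab
  obtain ⟨h3, h4⟩ := hf.convex.toReal_le hf.ne_bot hz.2.1 hw.2.1 ha hb hab
  refine ⟨h1, h3, ?_⟩
  have h5 : c = a * c + b * c := by rw [← add_mul, hab, one_mul]
  have h6 := mul_le_mul_of_nonneg_left hz.2.2 ha.le
  have h7 := mul_le_mul_of_nonneg_left hw.2.2 hb.le
  simp only [WithLp.add_fst, WithLp.add_snd, WithLp.smul_fst, WithLp.smul_snd]
  linarith

/-- Weak sequential lower semicontinuity of `(x, y) ↦ g x + f y`. -/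
theorem sum_le_of_weak_limit (hg : ProperConvexLSC g) (hf : ProperConvexLSC f) {ι : Type*}
    {l : Filter ι} [l.NeBot] {w : ι → PD H₁ H₂} {p : PD H₁ H₂}
    (hp : ∀ φ : StrongDual ℝ (PD H₁ H₂), Tendsto (fun k => φ (w k)) l (𝓝 (φ p)))
    {c : ι → ℝ} {c' : ℝ} (hc : Tendsto c l (𝓝 c'))
    (h : ∀ k, g (w k).fst ≠ ⊤ ∧ f (w k).snd ≠ ⊤ ∧
      (g (w k).fst).toReal + (f (w k).snd).toReal ≤ c k) :
    g p.fst ≠ ⊤ ∧ f p.snd ≠ ⊤ ∧ (g p.fst).toReal + (f p.snd).toReal ≤ c' := by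
  -- The bounds `c k` only converge to `c'`, so a fixed sublevel set needs the slack `δ`.
  have key : ∀ δ > 0, g p.fst ≠ ⊤ ∧ f p.snd ≠ ⊤ ∧
      (g p.fst).toReal + (f p.snd).toReal ≤ c' + δ := fun δ hδ => by
    rw [← ereal_add_le_iff (hg.ne_bot _) (hf.ne_bot _)]
    refine mem_of_weak_limit (C := {z : PD H₁ H₂ | g z.fst + f z.snd ≤ ((c' + δ : ℝ) : EReal)})
      (convex_sublevel hg hf (c' + δ)) (isClosed_sublevel hg hf (c' + δ)) ?_ hp
    filter_upwards [hc.eventually (gt_mem_nhds (by linarith : c' < c' + δ))] with k hk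
    rw [ereal_add_le_iff (hg.ne_bot _) (hf.ne_bot _)]
    exact ⟨(h k).1, (h k).2.1, (h k).2.2.trans hk.le⟩
  exact ⟨(key 1 one_pos).1, (key 1 one_pos).2.1,
    le_of_forall_pos_le_add fun δ hδ => (key δ hδ).2.2⟩

end Sublevel

section Saddle

variable {K : H₁ →L[ℝ] H₂} {g : H₁ → EReal} {f : H₂ → EReal} {G : H₁ → ℝ} {F : H₂ → ℝ}

/-- Finiteness of `g` and `f` at the saddle point lets the fixed terms cancel, which leaves two
separate minimisation problems. Points where the competing value is `⊤` are trivial. -/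
theorem IsSaddlePoint.toReal_le (hg : ∀ x, g x ≠ ⊥) (hf : ∀ x, f x ≠ ⊥) {z : PD H₁ H₂}
    (hz : IsSaddlePoint K g f G F z) :
    (∀ x, g z.fst + ((G z.fst + ⟪K z.fst, z.snd⟫_ℝ : ℝ) : EReal) ≤
      g x + ((G x + ⟪K x, z.snd⟫_ℝ : ℝ) : EReal)) ∧
    (∀ y, f z.snd + ((F z.snd - ⟪K z.fst, z.snd⟫_ℝ : ℝ) : EReal) ≤
      f y + ((F y - ⟪K z.fst, y⟫_ℝ : ℝ) : EReal)) := by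
  obtain ⟨h1, h2, h3, h4⟩ := hz
  lift g z.fst to ℝ using ⟨h1, hg _⟩ with a ha
  lift f z.snd to ℝ using ⟨h2, hf _⟩ with b hb
  constructor
  · intro x
    rcases eq_or_ne (g x) ⊤ with hx | hx
    · rw [hx, EReal.top_add_coe]; exact le_top
    · have h := h3 x
      unfold lagrangian at h
      rw [← ha, ← hb] at h
      rw [← EReal.coe_toReal hx (hg x)] at h ⊢
      norm_cast at h ⊢
      linarith
  · intro y
    rcases eq_or_ne (f y) ⊤ with hy | hy
    · rw [hy, EReal.top_add_coe]; exact le_top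
    · have h := h4 y
      unfold lagrangian at h
      rw [← ha, ← hb] at h
      rw [← EReal.coe_toReal hy (hf y)] at h ⊢
      norm_cast at h ⊢
      linarith

/-- Points satisfying the primal-dual gap inequality against all points of the domain are saddle
points. -/
theorem isSaddlePoint_of_gap (hg : ProperConvexLSC g) (hf : ProperConvexLSC f) {p : PD H₁ H₂}
    (h : ∀ x y, g x ≠ ⊤ → f y ≠ ⊤ → g p.fst ≠ ⊤ ∧ f p.snd ≠ ⊤ ∧
      (g p.fst).toReal + (f p.snd).toReal ≤ (g x).toReal + G x + (f y).toReal + F y -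
        G p.fst - F p.snd + ⟪K x, p.snd⟫_ℝ - ⟪K p.fst, y⟫_ℝ) : IsSaddlePoint K g f G F p := by
  obtain ⟨x₀, hx₀⟩ := hg.exists_ne_top
  obtain ⟨y₀, hy₀⟩ := hf.exists_ne_top
  obtain ⟨h1, h2, -⟩ := h x₀ y₀ hx₀ hy₀
  have e1 := EReal.coe_toReal h1 (hg.ne_bot _)
  have e2 := EReal.coe_toReal h2 (hf.ne_bot _)
  refine ⟨h1, h2, fun x => ?_, fun y => ?_⟩
  · unfold lagrangian
    rcases eq_or_ne (g x) ⊤ with hx | hx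
    · rw [hx, EReal.top_add_coe, ← e2, ← EReal.coe_add, EReal.top_sub_coe]
      exact le_top
    · have := (h x p.snd hx h2).2.2
      rw [← e1, ← e2, ← EReal.coe_toReal hx (hg.ne_bot x)]
      norm_cast
      linarith
  · unfold lagrangian
    rcases eq_or_ne (f y) ⊤ with hy | hy
    · rw [hy, EReal.top_add_coe, EReal.sub_top]
      exact bot_le
    · have := (h p.fst y h1 hy).2.2
      rw [← e1, ← e2, ← EReal.coe_toReal hy (hf.ne_bot y)]
      norm_cast
      linarith

end Saddle

variable [CompleteSpace H₁] [CompleteSpace H₂]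

/-- The operator `B (x, y) = (∇G x, ∇F y)`. -/
noncomputable def gradPair (G : H₁ → ℝ) (F : H₂ → ℝ) (z : PD H₁ H₂) : PD H₁ H₂ :=
  WithLp.toLp 2 (gradient G z.fst, gradient F z.snd)

@[simp] theorem gradPair_fst (G : H₁ → ℝ) (F : H₂ → ℝ) (z : PD H₁ H₂) :
    (gradPair G F z).fst = gradient G z.fst := rfl

@[simp] theorem gradPair_snd (G : H₁ → ℝ) (F : H₂ → ℝ) (z : PD H₁ H₂) :
    (gradPair G F z).snd = gradient F z.snd := rfl

theorem gradPair_cocoercive {G : H₁ → ℝ} {F : H₂ → ℝ} {β : ℝ} (hβ : 0 < β)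
    (hG : SmoothConvex (1 / β) G) (hF : SmoothConvex (1 / β) F) (z w : PD H₁ H₂) :
    β * ‖gradPair G F z - gradPair G F w‖ ^ 2 ≤ ⟪gradPair G F z - gradPair G F w, z - w⟫_ℝ := by
  have h1 := gradient_cocoercive hG.differentiable hG.convex hβ hG.lipschitz z.fst w.fst
  have h2 := gradient_cocoercive hF.differentiable hF.convex hβ hF.lipschitz z.snd w.snd
  rw [pd_norm_sq, pd_inner]
  simp only [WithLp.sub_fst, WithLp.sub_snd, gradPair_fst, gradPair_snd]
  linarith

theorem gradPair_stronglyMonotone {G : H₁ → ℝ} {F : H₂ → ℝ} (hG : Differentiable ℝ G)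
    (hF : Differentiable ℝ F) {m : ℝ} (hGm : StrongConvexOn Set.univ m G)
    (hFm : StrongConvexOn Set.univ m F) (z w : PD H₁ H₂) :
    m * ‖z - w‖ ^ 2 ≤ ⟪gradPair G F z - gradPair G F w, z - w⟫_ℝ := by
  have h1 := gradient_stronglyMonotone hG hGm z.fst w.fst
  have h2 := gradient_stronglyMonotone hF hFm z.snd w.snd
  rw [pd_norm_sq, pd_inner]
  simp only [WithLp.sub_fst, WithLp.sub_snd, gradPair_fst, gradPair_snd]
  linarith

/-- `u` belongs to the monotone operator `(x, y) ↦ (∂g x + K* y, ∂f y - K x)` at `z`, with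
subgradients of modulus `μ`. -/
def PDRel (μ : ℝ) (K : H₁ →L[ℝ] H₂) (g : H₁ → EReal) (f : H₂ → EReal) (z u : PD H₁ H₂) : Prop :=
  IsSub μ g z.fst (u.fst - ContinuousLinearMap.adjoint K z.snd) ∧
    IsSub μ f z.snd (u.snd + K z.fst)

variable {K : H₁ →L[ℝ] H₂} {g : H₁ → EReal} {f : H₂ → EReal} {G : H₁ → ℝ} {F : H₂ → ℝ}

/-- The two contributions of `K` are negatives of each other, so only the strong monotonicity of the
subdifferentials remains. -/
theorem PDRel.inner_le {μ : ℝ} {z w u v : PD H₁ H₂} (h : PDRel μ K g f z u)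
    (h' : PDRel μ K g f w v) : μ * ‖z - w‖ ^ 2 ≤ ⟪u - v, z - w⟫_ℝ := by
  have h1 := h.1.inner_le h'.1
  have h2 := h.2.inner_le h'.2
  have h3 : u.fst - ContinuousLinearMap.adjoint K z.snd -
      (v.fst - ContinuousLinearMap.adjoint K w.snd) =
      (u.fst - v.fst) - ContinuousLinearMap.adjoint K (z.snd - w.snd) := by
    rw [map_sub]; abel
  have h4 : u.snd + K z.fst - (v.snd + K w.fst) = (u.snd - v.snd) + K (z.fst - w.fst) := by
    rw [map_sub]; abel
  rw [h3, inner_sub_left, ContinuousLinearMap.adjoint_inner_left] at h1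
  rw [h4, inner_add_left, real_inner_comm] at h2
  rw [pd_norm_sq, pd_inner]
  simp only [WithLp.sub_fst, WithLp.sub_snd]
  rw [real_inner_comm (z.snd - w.snd) (K _)] at h2
  rw [real_inner_comm] at h2
  linarith

/-- First order conditions of the two partial minimisations: a saddle point is a zero of `A + B`. -/
theorem IsSaddlePoint.pdRel (hg : ProperConvexLSC g) (hf : ProperConvexLSC f) {μ : ℝ}
    (hgμ : ConvexWithModulus μ g) (hfμ : ConvexWithModulus μ f) (hG : Differentiable ℝ G)
    (hF : Differentiable ℝ F) {z : PD H₁ H₂} (hz : IsSaddlePoint K g f G F z) :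
    PDRel μ K g f z (-gradPair G F z) := by
  obtain ⟨h1, h2⟩ := hz.toReal_le hg.ne_bot hf.ne_bot
  constructor
  · refine isSub_of_minimizer hg.ne_bot hg.exists_ne_top hgμ
      (h := fun x => G x + ⟪K x, z.snd⟫_ℝ) h1 fun d => ?_
    have e1 := hasDerivAt_comp_line hG z.fst d 0
    have e2 := ((hasDerivAt_id (0 : ℝ)).mul_const ⟪K d, z.snd⟫_ℝ).const_add ⟪K z.fst, z.snd⟫_ℝ
    have e3 : (fun t : ℝ => G (z.fst + t • d) + ⟪K (z.fst + t • d), z.snd⟫_ℝ) =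
        fun t : ℝ => G (z.fst + t • d) + (⟪K z.fst, z.snd⟫_ℝ + t * ⟪K d, z.snd⟫_ℝ) := by
      funext t
      rw [map_add, map_smul, inner_add_left, real_inner_smul_left]
    rw [e3]
    refine (e1.add e2).congr_deriv ?_
    rw [zero_smul, add_zero, inner_sub_left, ContinuousLinearMap.adjoint_inner_left,
      real_inner_comm (K d)]
    simp only [gradPair_fst, WithLp.neg_fst, inner_neg_left]
    ring
  · refine isSub_of_minimizer hf.ne_bot hf.exists_ne_top hfμ
      (h := fun y => F y - ⟪K z.fst, y⟫_ℝ) h2 fun d => ?_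
    have e1 := hasDerivAt_comp_line hF z.snd d 0
    have e2 := ((hasDerivAt_id (0 : ℝ)).mul_const ⟪K z.fst, d⟫_ℝ).const_add ⟪K z.fst, z.snd⟫_ℝ
    have e3 : (fun t : ℝ => F (z.snd + t • d) - ⟪K z.fst, z.snd + t • d⟫_ℝ) =
        fun t : ℝ => F (z.snd + t • d) - (⟪K z.fst, z.snd⟫_ℝ + t * ⟪K z.fst, d⟫_ℝ) := by
      funext t
      rw [inner_add_right, real_inner_smul_right]
    rw [e3]
    refine (e1.sub e2).congr_deriv ?_
    rw [zero_smul, add_zero, inner_add_left]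
    simp only [gradPair_snd, WithLp.neg_snd, inner_neg_left]
    ring

/-- Demiclosedness of the primal-dual operator. -/
theorem isSaddlePoint_of_weak_limit (hg : ProperConvexLSC g) (hf : ProperConvexLSC f)
    (hG : Differentiable ℝ G) (hF : Differentiable ℝ F) (hGc : ConvexOn ℝ Set.univ G)
    (hFc : ConvexOn ℝ Set.univ F) {ι : Type*} {l : Filter ι} [l.NeBot] {w u : ι → PD H₁ H₂}
    {p : PD H₁ H₂} {R : ℝ} (hR : ∀ k, ‖w k‖ ≤ R)
    (hp : ∀ φ : StrongDual ℝ (PD H₁ H₂), Tendsto (fun k => φ (w k)) l (𝓝 (φ p)))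
    (hu : Tendsto u l (𝓝 0)) (h : ∀ k, PDRel 0 K g f (w k) (u k - gradPair G F (w k))) :
    IsSaddlePoint K g f G F p := by
  refine isSaddlePoint_of_gap hg hf fun x y hx hy => ?_
  -- Since `⟪K (w k).fst, (w k).snd⟫` cancels by skewness, and `G`, `F` are bounded below by their
  -- tangents at `p`, the upper bound is affine in `w k` up to the vanishing term with `u k`. Here
  -- `q` is its linear part, so the bound converges under weak convergence.
  let q : PD H₁ H₂ := WithLp.toLp 2 (-gradient G p.fst - ContinuousLinearMap.adjoint K y,
    -gradient F p.snd + K x)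
  let z : PD H₁ H₂ := WithLp.toLp 2 (x, y)
  have hlim : Tendsto (fun k => (g x).toReal + G x + (f y).toReal + F y - G p.fst - F p.snd -
      ⟪u k, z - w k⟫_ℝ + ⟪q, w k⟫_ℝ + ⟪gradPair G F p, p⟫_ℝ) l
      (𝓝 ((g x).toReal + G x + (f y).toReal + F y - G p.fst - F p.snd - 0 + ⟪q, p⟫_ℝ +
        ⟪gradPair G F p, p⟫_ℝ)) := by
    have h0 : Tendsto (fun k => ⟪u k, z - w k⟫_ℝ) l (𝓝 0) := by
      have h1 : Tendsto (fun k => ‖u k‖ * (‖z‖ + R)) l (𝓝 0) := by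
        simpa using (tendsto_norm_zero.comp hu).mul_const (‖z‖ + R)
      refine squeeze_zero_norm (fun k => ?_) h1
      exact (norm_inner_le_norm _ _).trans
        (by gcongr; exact (norm_sub_le _ _).trans (by gcongr; exact hR k))
    have h1 := hp (InnerProductSpace.toDual ℝ _ q)
    simp only [InnerProductSpace.toDual_apply_apply] at h1
    exact ((tendsto_const_nhds.sub h0).add h1).add tendsto_const_nhds
  obtain ⟨r1, r2, r3⟩ := sum_le_of_weak_limit hg hf hp hlim fun k => by
    obtain ⟨⟨a1, a2⟩, b1, b2⟩ := h k
    refine ⟨a1, b1, ?_⟩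
    have a3 := a2 x hx
    have b3 := b2 y hy
    have a4 := gradient_inequality hG (strongConvexOn_zero.2 hGc) (w k).fst x
    have b4 := gradient_inequality hF (strongConvexOn_zero.2 hFc) (w k).snd y
    have a5 := gradient_inequality hG (strongConvexOn_zero.2 hGc) p.fst (w k).fst
    have b5 := gradient_inequality hF (strongConvexOn_zero.2 hFc) p.snd (w k).snd
    simp only [pd_inner, q, z, WithLp.toLp_fst, WithLp.toLp_snd, gradPair_fst, gradPair_snd, WithLp.sub_fst, WithLp.sub_snd, inner_sub_left,
      inner_sub_right, inner_add_left, inner_neg_left, ContinuousLinearMap.adjoint_inner_left]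
      at a3 b3 a4 b4 a5 b5 ⊢
    rw [real_inner_comm (K x), real_inner_comm (K (w k).fst)] at a3
    rw [real_inner_comm (K (w k).fst) y]
    linarith
  refine ⟨r1, r2, r3.trans_eq ?_⟩
  simp only [pd_inner, q, WithLp.toLp_fst, WithLp.toLp_snd, gradPair_fst, gradPair_snd, inner_sub_left, inner_add_left, inner_neg_left,
    ContinuousLinearMap.adjoint_inner_left]
  rw [real_inner_comm (K p.fst) y]
  ring

end QNPDHG

/-! ### The main step as a forward-backward step. -/

namespace QNPDHG

variable {H₁ H₂ : Type*}
  [NormedAddCommGroup H₁] [InnerProductSpace ℝ H₁] [CompleteSpace H₁]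
  [NormedAddCommGroup H₂] [InnerProductSpace ℝ H₂] [CompleteSpace H₂]
  {K : H₁ →L[ℝ] H₂} {g : H₁ → EReal} {f : H₂ → EReal} {G : H₁ → ℝ} {F : H₂ → ℝ}

theorem adjoint_fstOp_add_sndOp {r : ℕ} (U : Rn r →L[ℝ] PD H₁ H₂) (a : PD H₁ H₂) :
    ContinuousLinearMap.adjoint (fstOp U) a.fst + ContinuousLinearMap.adjoint (sndOp U) a.snd =
      ContinuousLinearMap.adjoint U a := by
  refine ext_inner_right ℝ fun η => ?_
  rw [inner_add_left]
  simp only [ContinuousLinearMap.adjoint_inner_left]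
  rw [pd_inner]
  rfl

/-- The exact proximal points solve the inclusion `M (z - w) - B z ∈ A w` of a forward-backward
step in the quasi-Newton metric. -/
theorem pdRel_of_isProx (hg : ProperConvexLSC g) (hf : ProperConvexLSC f) {μ : ℝ}
    (hgμ : ConvexWithModulus μ g) (hfμ : ConvexWithModulus μ f) {T : H₁ ≃L[ℝ] H₁}
    {S : H₂ ≃L[ℝ] H₂} (hT : IsStepOperator T) (hS : IsStepOperator S) {r : ℕ} {s : ℝ}
    {U : Rn r →L[ℝ] PD H₁ H₂} {z w : PD H₁ H₂} {ξ : Rn r}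
    (hx : IsProx T g (primalArg K G T s U z ξ) w.fst)
    (hy : IsProx S f (dualArg K F S s U z ξ w.fst) w.snd)
    (hξ : ContinuousLinearMap.adjoint (fstOp U) (w.fst - z.fst) +
      ContinuousLinearMap.adjoint (sndOp U) (w.snd - z.snd) - ξ = 0) :
    PDRel μ K g f w (qnMetric K T S s U (z - w) - gradPair G F z) := by
  -- The root equation identifies `ξ` with `U* (w - z)`, so `s U U* (z - w) = - s U ξ`.
  have hξ' : ContinuousLinearMap.adjoint U (z - w) = -ξ := by
    rw [← neg_sub w z, map_neg, ← adjoint_fstOp_add_sndOp, WithLp.sub_fst, WithLp.sub_snd,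
      sub_eq_zero.1 hξ]
  have hM : qnMetric K T S s U (z - w) = WithLp.toLp 2
      (T.symm (z.fst - w.fst) - ContinuousLinearMap.adjoint K (z.snd - w.snd),
        -K (z.fst - w.fst) + S.symm (z.snd - w.snd)) - s • U ξ := by
    unfold qnMetric
    rw [add_apply, pdhgMetric_apply, smul_apply, ContinuousLinearMap.comp_apply, hξ', map_neg,
      smul_neg, ← sub_eq_add_neg]
    rfl
  constructor
  · convert hx.isSub hT hg hgμ using 1
    rw [hM]
    simp only [primalArg, WithLp.sub_fst, WithLp.toLp_fst, WithLp.smul_fst, gradPair_fst, map_sub,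
      map_smul, ContinuousLinearEquiv.symm_apply_apply]
    have : fstOp U ξ = (U ξ).fst := rfl
    rw [this]
    abel
  · convert hy.isSub hS hf hfμ using 1
    rw [hM]
    simp only [dualArg, WithLp.sub_snd, WithLp.toLp_snd, WithLp.smul_snd, gradPair_snd, map_sub,
      map_add, map_smul, ContinuousLinearEquiv.symm_apply_apply]
    have : sndOp U ξ = (U ξ).snd := rfl
    rw [this]
    module

/-- The main step is an exact forward-backward step up to an error that is controlled linearly. -/
theorem IsMainStep.exists_exact (hg : ProperConvexLSC g) (hf : ProperConvexLSC f) {μ : ℝ}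
    (hgμ : ConvexWithModulus μ g) (hfμ : ConvexWithModulus μ f) {T : H₁ ≃L[ℝ] H₁}
    {S : H₂ ≃L[ℝ] H₂} (hT : IsStepOperator T) (hS : IsStepOperator S) {r : ℕ} {s : ℝ}
    {U : Rn r →L[ℝ] PD H₁ H₂} {ε z w : PD H₁ H₂} (h : IsMainStep K g f G F T S s U ε z w) :
    ∃ e, PDRel μ K g f e (qnMetric K T S s U (z - e) - gradPair G F z) ∧
      ‖w - e‖ ≤ (2 + (‖(S : H₂ →L[ℝ] H₂)‖ + 1) * (2 * ‖K‖)) * ‖ε‖ := by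
  obtain ⟨ξ, ⟨x, y, hx, hy, hξ⟩, hwx, hwy⟩ := h
  have hxw := hwx.unique hT hg hx
  let e : PD H₁ H₂ := WithLp.toLp 2 (x, y)
  refine ⟨e, pdRel_of_isProx (w := e) hg hf hgμ hfμ hT hS hx hy hξ, ?_⟩
  set c := ‖(S : H₂ →L[ℝ] H₂)‖ + 1 with hc
  have h1 := hwy.inner_le hS hf hy
  -- The primal error enters the dual argument only through `w.fst`, shifting it by `S K (2 ε.fst)`;
  -- the Lipschitz estimate for the dual proximal map bounds the effect.
  have h2 : S.symm (dualArg K F S s U z ξ w.fst - dualArg K F S s U z ξ x) =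
      K ((2 : ℝ) • ε.fst) := by
    have : ε.fst = w.fst - x := by rw [← hxw]; abel
    rw [this]
    simp only [dualArg, map_sub, map_add, map_smul, ContinuousLinearEquiv.symm_apply_apply]
    module
  rw [h2] at h1
  have h3 : ‖K ((2 : ℝ) • ε.fst)‖ ≤ 2 * ‖K‖ * ‖ε.fst‖ := by
    rw [map_smul, norm_smul, Real.norm_of_nonneg zero_le_two]
    have := K.le_opNorm ε.fst
    linarith
  have h4 : ‖w.snd - ε.snd - y‖ ≤ c * (2 * ‖K‖ * ‖ε.fst‖) := by
    have h5 := (real_inner_le_norm (K ((2 : ℝ) • ε.fst)) (w.snd - ε.snd - y)).trans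
      (mul_le_mul_of_nonneg_right h3 (norm_nonneg _))
    rcases (norm_nonneg (w.snd - ε.snd - y)).eq_or_lt with h0 | h0
    · rw [← h0]; positivity
    · have h6 := h1.trans (mul_le_mul_of_nonneg_left h5 (by positivity : 0 ≤ c))
      rw [sq] at h6
      refine le_of_mul_le_mul_right (h6.trans_eq ?_) h0
      ring
  have h5 := pd_norm_le (w - e)
  have h6 : (w - e).fst = ε.fst := by
    change w.fst - x = ε.fst
    rw [← hxw]; abel
  have h7 : ‖(w - e).snd‖ ≤ ‖w.snd - ε.snd - y‖ + ‖ε.snd‖ := by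
    refine le_trans (le_of_eq ?_) (norm_add_le _ _)
    change ‖w.snd - y‖ = _
    congr 1
    abel
  rw [h6] at h5
  have h8 := pd_norm_fst_le ε
  have h9 := pd_norm_snd_le ε
  have h10 : c * (2 * ‖K‖ * ‖ε.fst‖) ≤ c * (2 * ‖K‖) * ‖ε‖ := by
    rw [mul_assoc c]; gcongr
  linarith

end QNPDHG

/-! ### Fejér inequalities and the inertial method. -/

namespace QNPDHG

variable {H : Type*} [NormedAddCommGroup H] [InnerProductSpace ℝ H]

/-- `β`-cocoercivity. -/
def Cocoercive (β : ℝ) (B : H → H) : Prop :=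
  ∀ x y, β * ‖B x - B y‖ ^ 2 ≤ ⟪B x - B y, x - y⟫_ℝ

theorem Cocoercive.norm_le {β : ℝ} (hβ : 0 < β) {B : H → H} (hB : Cocoercive β B) (x y : H) :
    ‖B x - B y‖ ≤ 1 / β * ‖x - y‖ := by
  have h := (hB x y).trans (real_inner_le_norm _ _)
  rw [one_div, inv_mul_eq_div, le_div_iff₀ hβ]
  rcases (norm_nonneg (B x - B y)).eq_or_lt with h0 | h0
  · rw [← h0, zero_mul]; positivity
  · refine le_of_mul_le_mul_left ?_ h0
    linarith

/-- The Fejér inequality for a forward-backward step. -/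
theorem forwardBackward_step {β : ℝ} (hβ : 0 < β) {B : H → H} {M : H →L[ℝ] H}
    (hs : ∀ x y, ⟪M x, y⟫_ℝ = ⟪M y, x⟫_ℝ) {x w p : H}
    (hB : Cocoercive β B) {μ : ℝ}
    (h : μ * ‖w - p‖ ^ 2 ≤ ⟪M (x - w) - B x + B p, w - p⟫_ℝ) :
    ⟪M (w - p), w - p⟫_ℝ + 2 * μ * ‖w - p‖ ^ 2 +
      (⟪M (x - w), x - w⟫_ℝ - 1 / (2 * β) * ‖x - w‖ ^ 2) ≤ ⟪M (x - p), x - p⟫_ℝ := by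
  have h1 : x - p = (x - w) + (w - p) := by abel
  have h0 : ⟪M (x - p), x - p⟫_ℝ = ⟪M (x - w), x - w⟫_ℝ + 2 * ⟪M (x - w), w - p⟫_ℝ +
      ⟪M (w - p), w - p⟫_ℝ := by rw [h1, inner_add_self hs]
  have h2 := hB x p
  have h3 : ⟪B x - B p, x - p⟫_ℝ = ⟪B x - B p, x - w⟫_ℝ + ⟪B x - B p, w - p⟫_ℝ := by
    rw [h1, inner_add_right]
  have h4 := real_inner_le_norm (B x - B p) (x - w)
  have h5 : ⟪M (x - w) - B x + B p, w - p⟫_ℝ = ⟪M (x - w), w - p⟫_ℝ - ⟪B x - B p, w - p⟫_ℝ := by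
    rw [← inner_sub_left]; congr 1; abel
  -- Both copies of `⟪B x - B p, x - p⟫` are spent on cocoercivity; completing the square costs `1 /
  -- (2 β)`.
  have h6 : 0 ≤ 2 * β * (‖B x - B p‖ - ‖x - w‖ / (2 * β)) ^ 2 := by positivity
  have h7 : 2 * β * (‖B x - B p‖ - ‖x - w‖ / (2 * β)) ^ 2 = 2 * β * ‖B x - B p‖ ^ 2 -
      2 * (‖B x - B p‖ * ‖x - w‖) + 1 / (2 * β) * ‖x - w‖ ^ 2 := by
    field_simp
    ring
  linarith

/-- The Fejér inequality for a forward-backward step with strongly monotone forward operator. -/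
theorem forwardBackward_step_strong {β : ℝ} (hβ : 0 < β) {B : H → H} {M : H →L[ℝ] H}
    (hs : ∀ x y, ⟪M x, y⟫_ℝ = ⟪M y, x⟫_ℝ) {x w p : H}
    (hB : Cocoercive β B) {m : ℝ}
    (hm : m * ‖x - p‖ ^ 2 ≤ ⟪B x - B p, x - p⟫_ℝ)
    (h : 0 ≤ ⟪M (x - w) - B x + B p, w - p⟫_ℝ) :
    ⟪M (w - p), w - p⟫_ℝ + m * ‖x - p‖ ^ 2 +
      (⟪M (x - w), x - w⟫_ℝ - 1 / β * ‖x - w‖ ^ 2) ≤ ⟪M (x - p), x - p⟫_ℝ := by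
  have h1 : x - p = (x - w) + (w - p) := by abel
  have h2 := hB x p
  have h3 : ⟪B x - B p, x - p⟫_ℝ = ⟪B x - B p, x - w⟫_ℝ + ⟪B x - B p, w - p⟫_ℝ := by
    rw [h1, inner_add_right]
  have h0 : ⟪M (x - p), x - p⟫_ℝ = ⟪M (x - w), x - w⟫_ℝ + 2 * ⟪M (x - w), w - p⟫_ℝ +
      ⟪M (w - p), w - p⟫_ℝ := by rw [h1, inner_add_self hs]
  have h4 := real_inner_le_norm (B x - B p) (x - w)
  have h5 : ⟪M (x - w) - B x + B p, w - p⟫_ℝ = ⟪M (x - w), w - p⟫_ℝ - ⟪B x - B p, w - p⟫_ℝ := by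
    rw [← inner_sub_left]; congr 1; abel
  -- Only one copy of `⟪B x - B p, x - p⟫` is spent on cocoercivity, the other on strong
  -- monotonicity. The cost rises to `1 / β`, which explains the stronger lower bound on the metrics
  -- in the rate.
  have h6 : 0 ≤ β * (‖B x - B p‖ - ‖x - w‖ / β) ^ 2 := by positivity
  have h7 : β * (‖B x - B p‖ - ‖x - w‖ / β) ^ 2 = β * ‖B x - B p‖ ^ 2 -
      2 * (‖B x - B p‖ * ‖x - w‖) + 1 / β * ‖x - w‖ ^ 2 := by
    field_simp
    ring
  linarith

theorem norm_le_mnorm [CompleteSpace H] {σ : ℝ} (hσ : 0 < σ) {M : H →L[ℝ] H} (hM : InS σ M)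
    (x : H) : ‖x‖ ≤ mnorm M x / √σ := by
  rw [le_div_iff₀ (Real.sqrt_pos.2 hσ), ← Real.sqrt_sq (norm_nonneg x),
    ← Real.sqrt_mul (sq_nonneg _), mul_comm]
  exact Real.sqrt_le_sqrt (hM.2 x)

theorem InS.add_le [CompleteSpace H] {e c : ℝ} {M : H →L[ℝ] H}
    (h : InS e (M - c • ContinuousLinearMap.id ℝ H)) (x : H) :
    e * ‖x‖ ^ 2 + c * ‖x‖ ^ 2 ≤ ⟪M x, x⟫_ℝ := by
  have := h.2 x
  simp only [sub_apply, smul_apply, ContinuousLinearMap.id_apply, inner_sub_left,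
    real_inner_smul_left, real_inner_self_eq_norm_sq] at this
  linarith

theorem tendsto_weak_of_norm_sub {ι : Type*} {l : Filter ι} {z w : ι → H} {p : H}
    (h : Tendsto (fun k => w k - z k) l (𝓝 0))
    (hz : ∀ φ : StrongDual ℝ H, Tendsto (fun k => φ (z k)) l (𝓝 (φ p))) (φ : StrongDual ℝ H) :
    Tendsto (fun k => φ (w k)) l (𝓝 (φ p)) := by
  have h1 := ((φ.continuous.tendsto 0).comp h).add (hz φ)
  simpa [Function.comp_def] using h1

section Inertial

variable [CompleteSpace H]
variable {β : ℝ} {B : H → H} {M : ℕ → H →L[ℝ] H} {ε : ℕ → H} {α : ℕ → ℝ} {zinit : H}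
  {z zh : ℕ → H} {Z : Set H} {C : ℝ}

/-- The extrapolated point. -/
def extrap (α : ℕ → ℝ) (zinit : H) (z : ℕ → H) (k : ℕ) : H := z k + α k • (z k - prev zinit z k)

theorem mnorm_extrap_le {p : H} {k : ℕ} (hα : 0 ≤ α k)
    (hM : ∀ x, 0 ≤ ⟪M k x, x⟫_ℝ) (hs : IsSelfAdjoint (M k)) :
    mnorm (M k) (extrap α zinit z k - p) ≤
      mnorm (M k) (z k - p) + α k * mnorm (M k) (z k - prev zinit z k) := by
  have h : extrap α zinit z k - p = (z k - p) + α k • (z k - prev zinit z k) := by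
    unfold extrap; abel
  rw [h, ← mnorm_smul _ hα]
  exact mnorm_add_le (inner_apply_comm hs) hM _ _

/-- The sequence of the perturbations in the quasi-Fejér inequality is summable, and the distances
to a point satisfying the forward-backward inequality are quasi-Fejér. -/
theorem inertial_quasiFejer (hβ : 0 < β) (hB : Cocoercive β B) (hA : Assumption1 β M ε)
    (hα : ∀ k, 0 ≤ α k)
    (hsum : Summable fun k => α k * max (mnorm (M k) (z k - prev zinit z k))
      (mnorm (M k) (z k - prev zinit z k) ^ 2))
    (hC : 0 ≤ C) (hstep : ∀ k, ‖z (k + 1) - zh k‖ ≤ C * ‖ε k‖) :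
    ∃ γ η : ℕ → ℝ, (∀ k, 0 ≤ γ k) ∧ Summable γ ∧ (∀ k, 0 ≤ η k) ∧ Summable η ∧
      (∀ k, α k * mnorm (M k) (z k - prev zinit z k) ≤ γ k) ∧
      (∀ k x, mnorm (M (k + 1)) x ≤ (1 + η k) * mnorm (M k) x) ∧
      ∀ p k, 0 ≤ ⟪M k (extrap α zinit z k - zh k) - B (extrap α zinit z k) + B p, zh k - p⟫_ℝ →
        mnorm (M k) (extrap α zinit z k - p) ≤ mnorm (M k) (z k - p) + γ k ∧
        mnorm (M k) (zh k - p) ≤ mnorm (M k) (extrap α zinit z k - p) ∧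
        mnorm (M (k + 1)) (z (k + 1) - p) ≤ (1 + η k) * (mnorm (M k) (zh k - p) + γ k) ∧
        mnorm (M (k + 1)) (z (k + 1) - p) ≤ (1 + η k) * (mnorm (M k) (z k - p) + γ k) := by
  obtain ⟨σ, hσ, hM⟩ := hA.mem
  obtain ⟨N, hN⟩ := hA.bdd
  have hN : ∀ k, ‖M k‖ ≤ N := fun k => hN ⟨k, rfl⟩
  obtain ⟨η, hη, hηs, hmono⟩ := hA.mono
  obtain ⟨e, he, hlow⟩ := hA.lower
  have hpos : ∀ k x, 0 ≤ ⟪M k x, x⟫_ℝ := fun k => (hM k).pos hσ.le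
  have hd := fun k => mnorm_nonneg (M k) (z k - prev zinit z k)
  have hN0 := Real.sqrt_nonneg N
  have hmm : ∀ k x, mnorm (M (k + 1)) x ≤ (1 + η k) * mnorm (M k) x := fun k x => by
    have h1 := hη k
    have h2 := mnorm_nonneg (M k) x
    refine abs_le_of_sq_le_sq' ?_ (by positivity) |>.2
    rw [mul_pow, mnorm_sq (hpos _ _), mnorm_sq (hpos _ _)]
    refine (hmono k x).trans (mul_le_mul_of_nonneg_right ?_ (hpos _ _))
    nlinarith
  have hγ1 : ∀ k, α k * mnorm (M k) (z k - prev zinit z k) ≤ α k *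
      max (mnorm (M k) (z k - prev zinit z k)) (mnorm (M k) (z k - prev zinit z k) ^ 2) :=
    fun k => mul_le_mul_of_nonneg_left (le_max_left _ _) (hα k)
  -- `γ k` collects the inertial displacement and the main step error, both measured in the norm of
  -- `M k`.
  refine ⟨fun k => α k * mnorm (M k) (z k - prev zinit z k) + √N * (C * ‖ε k‖), η,
    fun k => add_nonneg (mul_nonneg (hα k) (hd k)) (by positivity),
    (Summable.of_nonneg_of_le (fun k => mul_nonneg (hα k) (hd k)) hγ1 hsum).add
      ((hA.err.mul_left C).mul_left _), hη, hηs,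
    fun k => le_add_of_nonneg_right (by positivity), hmm, fun p k h => ?_⟩
  have h1 := mnorm_extrap_le (zinit := zinit) (z := z) (p := p) (hα k) (hpos k) (hM k).1
  have h0 : 0 ≤ √N * (C * ‖ε k‖) := by positivity
  have h2 : mnorm (M k) (zh k - p) ≤ mnorm (M k) (extrap α zinit z k - p) := by
    have h3 := forwardBackward_step (μ := 0) hβ (inner_apply_comm (hM k).1) hB
      (by rw [zero_mul]; exact h)
    have h4 := (hlow k).add_le (extrap α zinit z k - zh k)
    refine Real.sqrt_le_sqrt ?_
    have : 0 ≤ e * ‖extrap α zinit z k - zh k‖ ^ 2 := by positivity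
    linarith
  have h5 : mnorm (M k) (z (k + 1) - p) ≤ mnorm (M k) (zh k - p) + √N * (C * ‖ε k‖) := by
    have h6 : z (k + 1) - p = (zh k - p) + (z (k + 1) - zh k) := by abel
    rw [h6]
    refine (mnorm_add_le (inner_apply_comm (hM k).1) (hpos k) _ _).trans ?_
    gcongr
    exact (mnorm_le (hN k) _).trans (by gcongr; exact hstep k)
  have h7 : mnorm (M (k + 1)) (z (k + 1) - p) ≤ (1 + η k) * (mnorm (M k) (zh k - p) +
      √N * (C * ‖ε k‖)) := by
    refine (hmm k _).trans (mul_le_mul_of_nonneg_left h5 ?_)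
    linarith [hη k]
  have h8 : 0 ≤ 1 + η k := by linarith [hη k]
  have h9 := mul_nonneg (hα k) (hd k)
  refine ⟨by linarith, h2, h7.trans (mul_le_mul_of_nonneg_left (by linarith) h8),
    h7.trans (mul_le_mul_of_nonneg_left (by linarith) h8)⟩

/-- `zh` is the sequence of exact steps. The quasi-Fejér property makes the distances converge, the
term dropped from the Fejér inequality then forces `extrap - zh → 0`, and `hclus`, a demiclosedness
property, supplies the hypothesis of Opial's lemma on limit points. -/
theorem inertial_converges (hβ : 0 < β) (hB : Cocoercive β B) (hA : Assumption1 β M ε)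
    (hα : ∀ k, 0 ≤ α k)
    (hsum : Summable fun k => α k * max (mnorm (M k) (z k - prev zinit z k))
      (mnorm (M k) (z k - prev zinit z k) ^ 2))
    (hC : 0 ≤ C) (hstep : ∀ k, ‖z (k + 1) - zh k‖ ≤ C * ‖ε k‖) (hZ : Z.Nonempty)
    (hmono : ∀ p ∈ Z, ∀ k,
      0 ≤ ⟪M k (extrap α zinit z k - zh k) - B (extrap α zinit z k) + B p, zh k - p⟫_ℝ)
    (hclus : ∀ u : Ultrafilter ℕ, ∀ p, (∃ R, ∀ k, ‖zh k‖ ≤ R) →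
      (∀ φ : StrongDual ℝ H, Tendsto (fun k => φ (zh k)) u (𝓝 (φ p))) →
      Tendsto (fun k => M k (extrap α zinit z k - zh k) - B (extrap α zinit z k) + B (zh k)) u
        (𝓝 0) → p ∈ Z) :
    (∃ p ∈ Z, WeaklyTendsto z p) ∧
      ∀ p ∈ Z, ∃ l, Tendsto (fun k => mnorm (M k) (z k - p)) atTop (𝓝 l) := by
  obtain ⟨γ, η, hγ, hγs, hη, hηs, hαγ, -, hqf⟩ :=
    inertial_quasiFejer (zinit := zinit) (z := z) (zh := zh) hβ hB hA hα hsum hC hstep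
  obtain ⟨σ, hσ, hM⟩ := hA.mem
  obtain ⟨e, he, hlow⟩ := hA.lower
  have hpos : ∀ k x, 0 ≤ ⟪M k x, x⟫_ℝ := fun k => (hM k).pos hσ.le
  have hdist : ∀ p ∈ Z, ∃ l, Tendsto (fun k => mnorm (M k) (z k - p)) atTop (𝓝 l) :=
    fun p hp => exists_tendsto_of_quasiFejer (fun k => mnorm_nonneg _ _) hη hηs hγ hγs
      fun k => (hqf p k (hmono p hp k)).2.2.2
  refine ⟨?_, hdist⟩
  obtain ⟨p₀, hp₀⟩ := hZ
  obtain ⟨l, hl⟩ := hdist p₀ hp₀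
  have hγ0 := hγs.tendsto_atTop_zero
  have hη0 := hηs.tendsto_atTop_zero
  set zb := extrap α zinit z with hzb
  have hres : Tendsto (fun k => zb k - zh k) atTop (𝓝 0) := by
    -- The decrease of squared distances factors as `(a - b) (a + b)`: the first factor is bounded
    -- by a difference of convergent sequences with the same limit, the second by a bounded
    -- sequence.
    have hlim : Tendsto (fun k => (mnorm (M k) (z k - p₀) + γ k -
        (mnorm (M (k + 1)) (z (k + 1) - p₀) / (1 + η k) - γ k)) *
        (2 * (mnorm (M k) (z k - p₀) + γ k)) / e) atTop (𝓝 0) := by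
      have h1 := (((hl.add hγ0).sub ((((tendsto_add_atTop_iff_nat 1).2 hl).div
        (hη0.const_add 1) (by norm_num)).sub hγ0)).mul ((hl.add hγ0).const_mul 2)).div_const e
      simpa using h1
    have hsq : Tendsto (fun k => ‖zb k - zh k‖ ^ 2) atTop (𝓝 0) := by
      refine squeeze_zero (fun k => sq_nonneg _) (fun k => ?_) hlim
      obtain ⟨h1, h2, h3, -⟩ := hqf p₀ k (hmono p₀ hp₀ k)
      have h4 := forwardBackward_step (μ := 0) hβ (inner_apply_comm (hM k).1) hB
        (by rw [zero_mul]; exact hmono p₀ hp₀ k)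
      have h5 := (hlow k).add_le (zb k - zh k)
      have h6 : 0 < 1 + η k := by linarith [hη k]
      rw [← div_le_iff₀' h6] at h3
      rw [le_div_iff₀ he]
      rw [← mnorm_sq (hpos k (zh k - p₀)), ← mnorm_sq (hpos k (extrap α zinit z k - p₀))] at h4
      have h7 := mnorm_nonneg (M k) (zh k - p₀)
      calc ‖zb k - zh k‖ ^ 2 * e
          ≤ mnorm (M k) (zb k - p₀) ^ 2 - mnorm (M k) (zh k - p₀) ^ 2 := by linarith
        _ = (mnorm (M k) (zb k - p₀) - mnorm (M k) (zh k - p₀)) *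
            (mnorm (M k) (zb k - p₀) + mnorm (M k) (zh k - p₀)) := by ring
        _ ≤ _ := mul_le_mul (by linarith) (by linarith) (by linarith [h7.trans h2]) (by linarith)
    rw [tendsto_zero_iff_norm_tendsto_zero]
    simpa using hsq.sqrt
  have hzbz : Tendsto (fun k => zb k - z k) atTop (𝓝 0) := by
    refine squeeze_zero_norm (a := fun k => γ k / √σ) (fun k => ?_) (by simpa using hγ0.div_const _)
    have h1 : zb k - z k = α k • (z k - prev zinit z k) := by rw [hzb, extrap]; abel
    refine (norm_le_mnorm hσ (hM k) _).trans ?_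
    gcongr
    rw [h1, mnorm_smul _ (hα k)]
    exact hαγ k
  have hbdd : ∃ R, ∀ k, ‖zh k‖ ≤ R := by
    obtain ⟨R, hR⟩ := (hl.add hγ0).bddAbove_range
    refine ⟨R / √σ + ‖p₀‖, fun k => ?_⟩
    have h1 := norm_le_mnorm hσ (hM k) (zh k - p₀)
    obtain ⟨h2, h3, -⟩ := hqf p₀ k (hmono p₀ hp₀ k)
    have h4 : mnorm (M k) (zh k - p₀) ≤ R := (h3.trans h2).trans (hR ⟨k, rfl⟩)
    have h5 : mnorm (M k) (zh k - p₀) / √σ ≤ R / √σ := by gcongr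
    have h6 := norm_add_le (zh k - p₀) p₀
    rw [sub_add_cancel] at h6
    linarith
  obtain ⟨η', hη', hηs', hmono'⟩ := hA.mono
  refine exists_weaklyTendsto hσ hM (exists_tendsto_metric hσ.le hM hA.bdd hη' hηs' hmono')
    ⟨p₀, hp₀⟩ (fun p hp => ?_) fun u hu p hp => ?_
  · obtain ⟨l, hl⟩ := hdist p hp
    exact ⟨_, (hl.pow 2).congr fun k => mnorm_sq (hpos k _)⟩
  · obtain ⟨N, hN⟩ := hA.bdd
    have hN : ∀ k, ‖M k‖ ≤ N := fun k => hN ⟨k, rfl⟩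
    refine hclus u p hbdd (tendsto_weak_of_norm_sub (Tendsto.mono_left ?_ hu) hp)
      (Tendsto.mono_left ?_ hu)
    · have := hzbz.sub hres
      simpa using this
    · refine squeeze_zero_norm (a := fun k => (N + 1 / β) * ‖zb k - zh k‖) (fun k => ?_)
        (by simpa using (tendsto_zero_iff_norm_tendsto_zero.1 hres).const_mul (N + 1 / β))
      have h1 : M k (zb k - zh k) - B (zb k) + B (zh k) =
          M k (zb k - zh k) - (B (zb k) - B (zh k)) := by abel
      rw [h1, add_mul]
      exact (norm_sub_le _ _).trans (add_le_add ((M k).le_of_opNorm_le (hN k) _)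
        (hB.norm_le hβ _ _))

theorem inertial_rate (hA : Assumption1 β M ε)
    {Λ : ℝ} (hα : ∀ k, 0 < α k ∧ α k ≤ Λ) {p : H} {A : ℝ}
    (hbd : ∀ k, mnorm (M k) (z k - p) ≤ A) {q : ℝ} (hq0 : 0 ≤ q) (hq1 : q < 1)
    (hq : ∀ k, mnorm (M k) (z (k + 1) - p) ^ 2 ≤ q * mnorm (M k) (extrap α zinit z k - p) ^ 2) :
    ∃ δ ∈ Set.Ioo (0 : ℝ) 1, ∃ Θ > (0 : ℝ), ∃ K₀ : ℕ, ∀ k ≥ K₀,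
      mnorm (M k) (z k - p) ^ 2 ≤
        (1 - δ) ^ (k - K₀) * mnorm (M K₀) (z K₀ - p) ^ 2 +
        ∑ i ∈ Finset.Ico K₀ k, Θ * (1 - δ) ^ (k - i) * α i *
          max (mnorm (M i) (z i - prev zinit z i))
            (mnorm (M i) (z i - prev zinit z i) ^ 2) := by
  obtain ⟨σ, hσ, hM⟩ := hA.mem
  obtain ⟨η, hη, hηs, hmono⟩ := hA.mono
  have hpos : ∀ k x, 0 ≤ ⟪M k x, x⟫_ℝ := fun k => (hM k).pos hσ.le
  have hA0 : 0 ≤ A := (mnorm_nonneg _ _).trans (hbd 0)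
  have hΛ : 0 < Λ := (hα 0).1.trans_le (hα 0).2
  set m : ℕ → ℝ := fun i => max (mnorm (M i) (z i - prev zinit z i))
            (mnorm (M i) (z i - prev zinit z i) ^ 2) with hm
  -- The change of metric costs a factor `1 + η k`, which only eventually fits between `q` and `(1 +
  -- q) / 2`; this determines `K₀`.
  have hev : ∀ᶠ k in atTop, (1 + η k) * q < (1 + q) / 2 := by
    have h1 : Tendsto (fun k => (1 + η k) * q) atTop (𝓝 ((1 + 0) * q)) :=
      (hηs.tendsto_atTop_zero.const_add 1).mul_const q
    exact h1.eventually (gt_mem_nhds (by linarith))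
  obtain ⟨K₀, hK₀⟩ := eventually_atTop.1 hev
  -- `Θ = 2 A + Λ` comes from expanding `(a + α d)²` with `a ≤ A` and `α ≤ Λ`: the cross term is at
  -- most `2 A α m` and the square at most `Λ α m`.
  refine ⟨(1 - q) / 2, ⟨by linarith, by linarith⟩, 2 * A + Λ, by linarith, K₀, ?_⟩
  have hδ : 1 - (1 - q) / 2 = (1 + q) / 2 := by ring
  rw [hδ]
  set ρ := (1 + q) / 2 with hρ
  have hρ0 : 0 ≤ ρ := by linarith
  have hrec : ∀ k ≥ K₀, mnorm (M (k + 1)) (z (k + 1) - p) ^ 2 ≤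
      ρ * (mnorm (M k) (z k - p) ^ 2 + (2 * A + Λ) * (α k * m k)) := fun k hk => by
    have h1 : mnorm (M (k + 1)) (z (k + 1) - p) ^ 2 ≤
        (1 + η k) * mnorm (M k) (z (k + 1) - p) ^ 2 := by
      rw [mnorm_sq (hpos _ _), mnorm_sq (hpos _ _)]
      exact hmono k _
    have h2 := mnorm_extrap_le (zinit := zinit) (z := z) (p := p) (hα k).1.le (hpos k) (hM k).1
    have h3 : mnorm (M k) (extrap α zinit z k - p) ^ 2 ≤
        mnorm (M k) (z k - p) ^ 2 + (2 * A + Λ) * (α k * m k) := by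
      refine (pow_le_pow_left₀ (mnorm_nonneg _ _) h2 2).trans ?_
      set d := mnorm (M k) (z k - prev zinit z k) with hd
      set a := mnorm (M k) (z k - p) with ha
      have hd0 : 0 ≤ d := mnorm_nonneg _ _
      have ha0 : 0 ≤ a := mnorm_nonneg _ _
      have e1 : d ≤ m k := le_max_left _ _
      have e2 : d ^ 2 ≤ m k := le_max_right _ _
      obtain ⟨e3, e4⟩ := hα k
      have e5 : a * (α k * d) ≤ A * (α k * m k) :=
        mul_le_mul (hbd k) (by gcongr) (by positivity) hA0
      have e6 : α k * (α k * d ^ 2) ≤ Λ * (α k * m k) :=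
        mul_le_mul e4 (by gcongr) (by positivity) hΛ.le
      linarith
    have h4 : 0 ≤ 1 + η k := by linarith [hη k]
    calc _ ≤ (1 + η k) * (q * (mnorm (M k) (z k - p) ^ 2 + (2 * A + Λ) * (α k * m k))) :=
          h1.trans (mul_le_mul_of_nonneg_left ((hq k).trans
            (mul_le_mul_of_nonneg_left h3 hq0)) h4)
      _ = ((1 + η k) * q) * (mnorm (M k) (z k - p) ^ 2 + (2 * A + Λ) * (α k * m k)) := by ring
      _ ≤ _ := mul_le_mul_of_nonneg_right (hK₀ k hk).le ((sq_nonneg _).trans h3)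
  change ∀ k ≥ K₀, mnorm (M k) (z k - p) ^ 2 ≤ ρ ^ (k - K₀) * mnorm (M K₀) (z K₀ - p) ^ 2 +
    ∑ i ∈ Finset.Ico K₀ k, (2 * A + Λ) * ρ ^ (k - i) * α i * m i
  intro k hk
  induction k, hk using Nat.le_induction with
  | base => simp
  | succ k hk ih =>
    refine (hrec k hk).trans ?_
    rw [Finset.sum_Ico_succ_top hk, Nat.succ_sub hk, Nat.add_sub_cancel_left, pow_one, pow_succ ρ]
    have h1 : ∑ i ∈ Finset.Ico K₀ k, (2 * A + Λ) * ρ ^ (k + 1 - i) * α i * m i =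
        ρ * ∑ i ∈ Finset.Ico K₀ k, (2 * A + Λ) * ρ ^ (k - i) * α i * m i := by
      rw [Finset.mul_sum]
      refine Finset.sum_congr rfl fun i hi => ?_
      rw [Nat.succ_sub (Finset.mem_Ico.1 hi).2.le, pow_succ]
      ring
    rw [h1]
    have h2 := mul_le_mul_of_nonneg_left ih hρ0
    linarith

end Inertial

end QNPDHG

/-! ### The relaxed method. -/

namespace QNPDHG

variable {H : Type*} [NormedAddCommGroup H] [InnerProductSpace ℝ H]

/-- One relaxation step along `v`, when `v` nearly separates `z` from `p`. -/
theorem relaxation_step {z w v p : H} {c L κ : ℝ} (hc : 0 < c) (hL : 0 < L)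
    (hn : c * ‖z - w‖ ^ 2 ≤ ⟪z - w, v⟫_ℝ) (hv : ‖v‖ ≤ L * ‖z - w‖)
    (hκ : -κ ≤ ⟪v, w - p⟫_ℝ) :
    ‖z - (⟪z - w, v⟫_ℝ / (2 * ‖v‖ ^ 2)) • v - p‖ ^ 2 ≤
        ‖z - p‖ ^ 2 - 3 / 4 * (c / L) ^ 2 * ‖z - w‖ ^ 2 +
          2 * (⟪z - w, v⟫_ℝ / (2 * ‖v‖ ^ 2)) * κ ∧
      0 ≤ ⟪z - w, v⟫_ℝ / (2 * ‖v‖ ^ 2) ∧ ⟪z - w, v⟫_ℝ / (2 * ‖v‖ ^ 2) ≤ 1 / (2 * c) ∧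
      (v ≠ 0 → c / (2 * L ^ 2) ≤ ⟪z - w, v⟫_ℝ / (2 * ‖v‖ ^ 2)) := by
  set n := ⟪z - w, v⟫_ℝ with hndef
  have hn0 : 0 ≤ n := le_trans (by positivity) hn
  -- If `v = 0` then `z = w` and the quotient is `0` by the convention for division by zero.
  rcases eq_or_ne v 0 with h0 | h0
  · have hn1 : n = 0 := by rw [hndef, h0, inner_zero_right]
    have hd : ‖z - w‖ ^ 2 ≤ 0 := by
      rw [hn1] at hn
      by_contra hcon
      push Not at hcon
      linarith [mul_pos hc hcon]
    have hd' : ‖z - w‖ ^ 2 = 0 := le_antisymm hd (sq_nonneg _)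
    rw [hn1, hd', h0]
    refine ⟨by simp, by simp, by simp; positivity, fun h => absurd rfl h⟩
  · have hv0 : 0 < ‖v‖ := norm_pos_iff.2 h0
    set t := n / (2 * ‖v‖ ^ 2) with ht
    have ht0 : 0 ≤ t := by positivity
    have hd0 : 0 < ‖z - w‖ := by
      by_contra hcon
      push Not at hcon
      have : L * ‖z - w‖ ≤ 0 := mul_nonpos_of_nonneg_of_nonpos hL.le hcon
      linarith
    have htv : t * ‖v‖ ^ 2 = n / 2 := by rw [ht]; field_simp
    have hcv : c * ‖z - w‖ ≤ ‖v‖ := by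
      have h1 := hn.trans (real_inner_le_norm _ _)
      refine le_of_mul_le_mul_left ?_ hd0
      linarith
    have hnv : n ≤ ‖z - w‖ * ‖v‖ := real_inner_le_norm _ _
    have htup : t ≤ 1 / (2 * c) := by
      rw [ht, div_le_div_iff₀ (by positivity) (by positivity)]
      have : c * n ≤ ‖v‖ * ‖v‖ :=
        calc c * n ≤ c * (‖z - w‖ * ‖v‖) := by gcongr
          _ = (c * ‖z - w‖) * ‖v‖ := by ring
          _ ≤ ‖v‖ * ‖v‖ := by gcongr
      linarith
    have htlow : c / (2 * L ^ 2) ≤ t := by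
      rw [ht, div_le_div_iff₀ (by positivity) (by positivity)]
      have : c * ‖v‖ ^ 2 ≤ n * L ^ 2 :=
        calc c * ‖v‖ ^ 2 ≤ c * (L * ‖z - w‖) ^ 2 := by gcongr
          _ = (c * ‖z - w‖ ^ 2) * L ^ 2 := by ring
          _ ≤ n * L ^ 2 := by gcongr
      linarith
    refine ⟨?_, ht0, htup, fun _ => htlow⟩
    have h1 : z - t • v - p = (z - p) - t • v := by abel
    rw [h1, norm_sub_sq_real, real_inner_smul_right, norm_smul, Real.norm_of_nonneg ht0]
    have h2 : ⟪z - p, v⟫_ℝ = n + ⟪v, w - p⟫_ℝ := by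
      rw [hndef, real_inner_comm (w - p) v, ← inner_add_left]
      congr 1; abel
    have h3 : t * (n - κ) ≤ t * ⟪z - p, v⟫_ℝ := mul_le_mul_of_nonneg_left (by linarith) ht0
    have h4 : c / (2 * L ^ 2) * (c * ‖z - w‖ ^ 2) ≤ t * n :=
      mul_le_mul htlow hn (by positivity) ht0
    have h5 : c / (2 * L ^ 2) * (c * ‖z - w‖ ^ 2) = 1 / 2 * ((c / L) ^ 2 * ‖z - w‖ ^ 2) := by
      field_simp
    -- Half of the projection step is taken, so the quadratic term returns only `t n / 2` of the
    -- gain `2 t n`; with `t n ≥ (c / L)² ‖z - w‖² / 2` this gives the constant `3 / 4`.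
    have h6 : (t * ‖v‖) ^ 2 = t * n / 2 := by
      rw [mul_pow, sq t, mul_assoc, htv]; ring
    rw [h6]
    linarith

section Relaxed

variable {β : ℝ} {B : H → H} {M : ℕ → H →L[ℝ] H} {ε : ℕ → H} {z zh w : ℕ → H} {Z : Set H} {C : ℝ}

theorem norm_metric_add_sub_le (hβ : 0 < β) (hB : Cocoercive β B) {M : H →L[ℝ] H} {N : ℝ}
    (hN : ‖M‖ ≤ N) (x y : H) : ‖M (x - y) + B y - B x‖ ≤ (N + 1 / β) * ‖x - y‖ := by
  have h1 : M (x - y) + B y - B x = M (x - y) - (B x - B y) := by abel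
  rw [h1, add_mul]
  exact (norm_sub_le _ _).trans (add_le_add (M.le_of_opNorm_le hN _) (hB.norm_le hβ _ _))

theorem Cocoercive.inner_nonneg (hβ : 0 < β) (hB : Cocoercive β B) (x y : H) :
    0 ≤ ⟪B x - B y, x - y⟫_ℝ := le_trans (by positivity) (hB x y)

theorem inner_residual_eq (M : H →L[ℝ] H) (B : H → H) (x y p : H) :
    ⟪M (x - y) + B y - B x, y - p⟫_ℝ =
      ⟪M (x - y) - B x + B p, y - p⟫_ℝ + ⟪B y - B p, y - p⟫_ℝ := by
  rw [← inner_add_left]; congr 1; abel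

variable [CompleteSpace H]

theorem inner_metric_add_sub_ge (hβ : 0 < β) (hB : Cocoercive β B) {M : H →L[ℝ] H} {c : ℝ}
    (hM : InS c (M - (1 / β) • ContinuousLinearMap.id ℝ H)) (x y : H) :
    c * ‖x - y‖ ^ 2 ≤ ⟪x - y, M (x - y) + B y - B x⟫_ℝ := by
  have h1 : M (x - y) + B y - B x = M (x - y) - (B x - B y) := by abel
  have h2 := hM.add_le (x - y)
  have h3 := real_inner_le_norm (B x - B y) (x - y)
  have h4 := mul_le_mul_of_nonneg_right (hB.norm_le hβ x y) (norm_nonneg (x - y))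
  rw [h1, real_inner_comm, inner_sub_left]
  linarith

/-- The exact residual at `zh k` is an element of `(A + B) (zh k)`, so it has nonnegative product
with `zh k - p`; replacing `zh k` by the computed `w k` costs a summable amount. This is a
quasi-Fejér inequality in the original norm. -/
theorem relaxed_converges (hβ : 0 < β) (hB : Cocoercive β B) (hA : Assumption2 β M ε)
    (hw : ∀ k, ‖w k - zh k‖ ≤ C * ‖ε k‖)
    (hz : ∀ k, z (k + 1) = z k - (⟪z k - w k, M k (z k - w k) + B (w k) - B (z k)⟫_ℝ /
      (2 * ‖M k (z k - w k) + B (w k) - B (z k)‖ ^ 2)) •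
        (M k (z k - w k) + B (w k) - B (z k)))
    (hZ : Z.Nonempty)
    (hmono : ∀ p ∈ Z, ∀ k, 0 ≤ ⟪M k (z k - zh k) - B (z k) + B p, zh k - p⟫_ℝ)
    (hclus : ∀ u : Ultrafilter ℕ, ∀ p, (∃ R, ∀ k, ‖zh k‖ ≤ R) →
      (∀ φ : StrongDual ℝ H, Tendsto (fun k => φ (zh k)) u (𝓝 (φ p))) →
      Tendsto (fun k => M k (z k - zh k) - B (z k) + B (zh k)) u (𝓝 0) → p ∈ Z) :
    ∃ p ∈ Z, WeaklyTendsto z p := by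
  obtain ⟨σ, hσ, hM⟩ := hA.mem
  obtain ⟨c, hc, hlow⟩ := hA.lower
  obtain ⟨N, hN⟩ := hA.bdd
  have hN : ∀ k, ‖M k‖ ≤ N := fun k => hN ⟨k, rfl⟩
  have hN0 : 0 ≤ N := (norm_nonneg _).trans (hN 0)
  have hpos : ∀ k x, 0 ≤ ⟪M k x, x⟫_ℝ := fun k => (hM k).pos hσ.le
  set L := N + 1 / β with hL
  have hL0 : 0 < L := by positivity
  set D := √N / √σ with hD
  have hD0 : 0 ≤ D := by positivity
  set e : ℕ → ℝ := fun k => ‖w k - zh k‖ with he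
  have he0 : ∀ k, 0 ≤ e k := fun k => norm_nonneg _
  have hes : Summable e := Summable.of_nonneg_of_le he0 hw (hA.err.mul_left C)
  obtain ⟨E, hE⟩ := hes.tendsto_atTop_zero.bddAbove_range
  have hE : ∀ k, e k ≤ E := fun k => hE ⟨k, rfl⟩
  have hE0 : 0 ≤ E := (he0 0).trans (hE 0)
  -- The step is nonexpansive towards `p` in the norm of `M k`; passing to the original norm costs
  -- `D = √N / √σ`, uniformly in `k`.
  have hzh : ∀ p ∈ Z, ∀ k, ‖zh k - p‖ ≤ D * ‖z k - p‖ := fun p hp k => by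
    have h1 := forwardBackward_step (μ := 0) hβ (inner_apply_comm (hM k).1) hB
      (by rw [zero_mul]; exact hmono p hp k)
    have h2 := (hlow k).add_le (z k - zh k)
    have h3 : mnorm (M k) (zh k - p) ≤ mnorm (M k) (z k - p) := by
      refine Real.sqrt_le_sqrt ?_
      have h4 : 0 ≤ c * ‖z k - zh k‖ ^ 2 := by positivity
      have h5 : 1 / (2 * β) * ‖z k - zh k‖ ^ 2 ≤ 1 / β * ‖z k - zh k‖ ^ 2 := by
        gcongr; linarith
      linarith
    calc ‖zh k - p‖ ≤ mnorm (M k) (zh k - p) / √σ := norm_le_mnorm hσ (hM k) _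
      _ ≤ √N * ‖z k - p‖ / √σ := by gcongr; exact h3.trans (mnorm_le (hN k) _)
      _ = D * ‖z k - p‖ := by rw [hD]; ring
  set Q := L / c * (1 + 2 * D) with hQ
  have hQ0 : 0 ≤ Q := by positivity
  -- The separation error is linear in `a = ‖z k - p‖`; bounding `a ≤ 1 + a²` splits it into a
  -- multiplicative and an additive summable perturbation.
  have hrec : ∀ p ∈ Z, ∀ k, ‖z (k + 1) - p‖ ^ 2 + 3 / 4 * (c / L) ^ 2 * ‖z k - w k‖ ^ 2 ≤
      (1 + Q * e k) * (‖z k - p‖ ^ 2 + Q * (1 + E) * e k) := fun p hp k => by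
    set v := M k (z k - w k) + B (w k) - B (z k) with hv
    set a := ‖z k - p‖ with ha
    have ha0 : 0 ≤ a := norm_nonneg _
    have h1 := hzh p hp k
    have hres := inner_residual_eq (M k) B (z k) (zh k) p
    set vh := M k (z k - zh k) + B (zh k) - B (z k) with hvh
    have h2 : 0 ≤ ⟪vh, zh k - p⟫_ℝ := by
      rw [hres]
      exact add_nonneg (hmono p hp k) (hB.inner_nonneg hβ _ _)
    have h3 : ‖vh‖ ≤ L * ((1 + D) * a) := by
      refine (norm_metric_add_sub_le hβ hB (hN k) _ _).trans ?_
      gcongr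
      have : z k - zh k = (z k - p) - (zh k - p) := by abel
      rw [this]
      refine (norm_sub_le _ _).trans ?_
      linarith
    have h4 : ‖v - vh‖ ≤ L * e k := by
      have : v - vh = M k (zh k - w k) + B (w k) - B (zh k) := by
        have h5 : zh k - w k = (z k - w k) - (z k - zh k) := by abel
        rw [hv, hvh, h5]; simp only [map_sub]; abel
      rw [this]
      refine (norm_metric_add_sub_le hβ hB (hN k) _ _).trans_eq ?_
      rw [norm_sub_rev]
    have h5 : ‖w k - p‖ ≤ e k + D * a := by
      have : w k - p = (w k - zh k) + (zh k - p) := by abel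
      rw [this]
      exact (norm_add_le _ _).trans (by gcongr)
    have h6 : -(L * e k * ((1 + 2 * D) * a + e k)) ≤ ⟪v, w k - p⟫_ℝ := by
      have e1 : ⟪v, w k - p⟫_ℝ =
          ⟪vh, zh k - p⟫_ℝ + ⟪vh, w k - zh k⟫_ℝ + ⟪v - vh, w k - p⟫_ℝ := by
        have e0 : ⟪vh, w k - p⟫_ℝ = ⟪vh, zh k - p⟫_ℝ + ⟪vh, w k - zh k⟫_ℝ := by
          rw [← inner_add_right]; congr 1; abel
        rw [inner_sub_left v vh, e0]; ring
      have e2 := (abs_real_inner_le_norm vh (w k - zh k)).trans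
        (mul_le_mul_of_nonneg_right h3 (norm_nonneg _))
      have e3 := (abs_real_inner_le_norm (v - vh) (w k - p)).trans
        (mul_le_mul h4 h5 (norm_nonneg _) (mul_nonneg hL0.le (he0 k)))
      have e4 := neg_abs_le ⟪vh, w k - zh k⟫_ℝ
      have e5 := neg_abs_le ⟪v - vh, w k - p⟫_ℝ
      have e6 : L * ((1 + D) * a) * ‖w k - zh k‖ + L * e k * (e k + D * a) =
          L * e k * ((1 + 2 * D) * a + e k) := by simp only [he]; ring
      linarith
    obtain ⟨r1, r2, r3, -⟩ := relaxation_step hc hL0 (inner_metric_add_sub_ge hβ hB (hlow k) _ _)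
      (norm_metric_add_sub_le hβ hB (hN k) (z k) (w k)) h6
    rw [hz k]
    set t := ⟪z k - w k, v⟫_ℝ / (2 * ‖v‖ ^ 2) with ht
    have hek := he0 k
    have h7 : 2 * t * (L * e k * ((1 + 2 * D) * a + e k)) ≤
        1 / c * (L * e k * ((1 + 2 * D) * a + e k)) := by
      gcongr
      calc 2 * t ≤ 2 * (1 / (2 * c)) := by gcongr
        _ = 1 / c := by field_simp
    have h8 : 1 / c * (L * e k * ((1 + 2 * D) * a + e k)) ≤ Q * e k * (1 + a ^ 2 + E) := by
      have e1 : a ≤ 1 + a ^ 2 := by nlinarith [sq_nonneg (a - 1 / 2)]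
      have e2 : (1 + 2 * D) * a + e k ≤ (1 + 2 * D) * (1 + a ^ 2 + E) := by
        have := hE k
        have : 0 ≤ D * (1 + a ^ 2 - a) := mul_nonneg hD0 (by linarith)
        have : 0 ≤ D * E := by positivity
        linarith
      calc 1 / c * (L * e k * ((1 + 2 * D) * a + e k))
          ≤ 1 / c * (L * e k * ((1 + 2 * D) * (1 + a ^ 2 + E))) := by gcongr
        _ = Q * e k * (1 + a ^ 2 + E) := by rw [hQ]; ring
    have h9 : 0 ≤ (Q * e k) * (Q * (1 + E) * e k) := by positivity
    linarith
  have hQes : Summable fun k => Q * e k := hes.mul_left Q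
  have hQEs : Summable fun k => Q * (1 + E) * e k := hes.mul_left _
  have hdist : ∀ p ∈ Z, ∃ l, Tendsto (fun k => ‖z k - p‖ ^ 2) atTop (𝓝 l) := fun p hp =>
    exists_tendsto_of_quasiFejer (fun k => sq_nonneg _) (fun k => mul_nonneg hQ0 (he0 k)) hQes
      (fun k => mul_nonneg (by positivity) (he0 k)) hQEs fun k => by
        have h1 := hrec p hp k
        have h2 : 0 ≤ 3 / 4 * (c / L) ^ 2 * ‖z k - w k‖ ^ 2 := by positivity
        linarith
  obtain ⟨p₀, hp₀⟩ := hZ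
  obtain ⟨l, hl⟩ := hdist p₀ hp₀
  have hzw : Tendsto (fun k => z k - w k) atTop (𝓝 0) := by
    have hk : 0 < 3 / 4 * (c / L) ^ 2 := by positivity
    have hsq : Tendsto (fun k => ‖z k - w k‖ ^ 2) atTop (𝓝 0) := by
      have h1 := (((hQes.tendsto_atTop_zero.const_add 1).mul
        (hl.add hQEs.tendsto_atTop_zero)).sub ((tendsto_add_atTop_iff_nat 1).2 hl)).div_const
          (3 / 4 * (c / L) ^ 2)
      refine squeeze_zero (fun k => sq_nonneg _) (fun k => ?_) (by simpa using h1)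
      rw [le_div_iff₀ hk]
      linarith [hrec p₀ hp₀ k]
    rw [tendsto_zero_iff_norm_tendsto_zero]
    simpa using hsq.sqrt
  have hzzh : Tendsto (fun k => z k - zh k) atTop (𝓝 0) := by
    have h1 : Tendsto (fun k => w k - zh k) atTop (𝓝 0) :=
      tendsto_zero_iff_norm_tendsto_zero.2 hes.tendsto_atTop_zero
    simpa using hzw.add h1
  have hbdd : ∃ R, ∀ k, ‖zh k‖ ≤ R := by
    obtain ⟨R, hR⟩ := hl.sqrt.bddAbove_range
    refine ⟨D * R + ‖p₀‖, fun k => ?_⟩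
    have h1 : ‖z k - p₀‖ ≤ R := by
      have := hR ⟨k, rfl⟩
      simpa using this
    have h2 := norm_add_le (zh k - p₀) p₀
    rw [sub_add_cancel] at h2
    have h3 := (hzh p₀ hp₀ k).trans (mul_le_mul_of_nonneg_left h1 hD0)
    linarith
  refine exists_weaklyTendsto (M := fun _ => ContinuousLinearMap.id ℝ H) one_pos
    (fun _ => ⟨IsSelfAdjoint.one _, fun x => ?_⟩) (fun x => ⟨x, tendsto_const_nhds⟩) ⟨p₀, hp₀⟩
    (fun p hp => ?_) fun u hu p hp => ?_
  · rw [one_mul, ContinuousLinearMap.id_apply, real_inner_self_eq_norm_sq]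
  · obtain ⟨l, hl⟩ := hdist p hp
    exact ⟨l, hl.congr fun k => by
      rw [ContinuousLinearMap.id_apply, real_inner_self_eq_norm_sq]⟩
  · refine hclus u p hbdd (tendsto_weak_of_norm_sub (Tendsto.mono_left ?_ hu) hp)
      (Tendsto.mono_left ?_ hu)
    · simpa using hzzh.neg
    · refine squeeze_zero_norm (a := fun k => L * ‖z k - zh k‖) (fun k => ?_)
        (by simpa using (tendsto_zero_iff_norm_tendsto_zero.1 hzzh).const_mul L)
      have h1 : M k (z k - zh k) - B (z k) + B (zh k) = M k (z k - zh k) + B (zh k) - B (z k) := by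
        abel
      rw [h1]
      exact norm_metric_add_sub_le hβ hB (hN k) _ _

/-- Strong monotonicity makes the separation strict: `relaxation_step` applies with the negative
value `κ = -μ ‖w k - p‖²`. The decrease then controls both `‖z k - w k‖²` and `‖w k - p‖²`, hence
`‖z k - p‖²`. -/
theorem relaxed_rate (hβ : 0 < β) (hB : Cocoercive β B) (hA : Assumption2 β M ε)
    (hz : ∀ k, z (k + 1) = z k - (⟪z k - w k, M k (z k - w k) + B (w k) - B (z k)⟫_ℝ /
      (2 * ‖M k (z k - w k) + B (w k) - B (z k)‖ ^ 2)) •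
        (M k (z k - w k) + B (w k) - B (z k))) {p : H} {μ : ℝ} (hμ : 0 < μ)
    (hmono : ∀ k, μ * ‖w k - p‖ ^ 2 ≤ ⟪M k (z k - w k) + B (w k) - B (z k), w k - p⟫_ℝ) :
    ∃ δ ∈ Set.Ioo (0 : ℝ) 1, ∀ k, ‖z k - p‖ ^ 2 ≤ (1 - δ) ^ k * ‖z 0 - p‖ ^ 2 := by
  obtain ⟨c, hc, hlow⟩ := hA.lower
  obtain ⟨N, hN⟩ := hA.bdd
  have hN : ∀ k, ‖M k‖ ≤ N := fun k => hN ⟨k, rfl⟩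
  have hN0 : 0 ≤ N := (norm_nonneg _).trans (hN 0)
  set L := N + 1 / β with hL
  have hL0 : 0 < L := by positivity
  set κ := min (3 / 4 * (c / L) ^ 2) (2 * (c / (2 * L ^ 2)) * μ) with hκ
  have hκ0 : 0 < κ := lt_min (by positivity) (by positivity)
  set δ := min (κ / 2) (1 / 2) with hδ
  have hδ0 : 0 < δ := lt_min (by positivity) (by norm_num)
  have hδ1 : δ ≤ 1 / 2 := min_le_right _ _
  have hstep : ∀ k, ‖z (k + 1) - p‖ ^ 2 ≤ (1 - δ) * ‖z k - p‖ ^ 2 := fun k => by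
    have hm := hmono k
    obtain ⟨r1, r2, -, r4⟩ := relaxation_step (p := p) (κ := -(μ * ‖w k - p‖ ^ 2)) hc hL0
      (inner_metric_add_sub_ge hβ hB (hlow k) _ _)
      (norm_metric_add_sub_le hβ hB (hN k) (z k) (w k)) (by rw [neg_neg]; exact hm)
    have hge := inner_metric_add_sub_ge hβ hB (hlow k) (z k) (w k)
    rw [hz k]
    set v := M k (z k - w k) + B (w k) - B (z k) with hv
    -- The lower bound on the step length requires `v ≠ 0`; if `v = 0`, then `z k = w k = p`.
    rcases eq_or_ne v 0 with h0 | h0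
    · rw [h0, inner_zero_right] at hge
      rw [h0, inner_zero_left] at hm
      have h1 : ‖z k - w k‖ = 0 := by
        by_contra hcon
        have : 0 < c * ‖z k - w k‖ ^ 2 := by positivity
        linarith
      have h2 : ‖w k - p‖ = 0 := by
        by_contra hcon
        have : 0 < μ * ‖w k - p‖ ^ 2 := by positivity
        linarith
      have h3 : z k - p = 0 := by
        rw [← sub_add_sub_cancel (z k) (w k) p, norm_eq_zero.1 h1, norm_eq_zero.1 h2, add_zero]
      rw [h0, smul_zero, sub_zero, h3]
      simp
    · have h1 := r4 h0
      set t := ⟪z k - w k, v⟫_ℝ / (2 * ‖v‖ ^ 2) with ht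
      have h2 : κ * ‖w k - p‖ ^ 2 ≤ 2 * t * (μ * ‖w k - p‖ ^ 2) := by
        calc κ * ‖w k - p‖ ^ 2 ≤ (2 * (c / (2 * L ^ 2)) * μ) * ‖w k - p‖ ^ 2 := by
              gcongr; exact min_le_right _ _
          _ ≤ (2 * t * μ) * ‖w k - p‖ ^ 2 := by gcongr
          _ = _ := by ring
      have h3 : κ * ‖z k - w k‖ ^ 2 ≤ 3 / 4 * (c / L) ^ 2 * ‖z k - w k‖ ^ 2 := by
        gcongr; exact min_le_left _ _
      have h4 : ‖z k - p‖ ^ 2 ≤ 2 * (‖z k - w k‖ ^ 2 + ‖w k - p‖ ^ 2) := by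
        have h5 := norm_add_le (z k - w k) (w k - p)
        rw [sub_add_sub_cancel] at h5
        have h6 := pow_le_pow_left₀ (norm_nonneg _) h5 2
        linarith [sq_nonneg (‖z k - w k‖ - ‖w k - p‖)]
      have h5 : δ * ‖z k - p‖ ^ 2 ≤ κ / 2 * (2 * (‖z k - w k‖ ^ 2 + ‖w k - p‖ ^ 2)) :=
        mul_le_mul (min_le_left _ _) h4 (sq_nonneg _) (by positivity)
      linarith
  refine ⟨δ, ⟨hδ0, by linarith⟩, fun k => ?_⟩
  induction k with
  | zero => simp
  | succ k ih =>
    refine (hstep k).trans ?_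
    rw [pow_succ' (1 - δ), mul_assoc]
    exact mul_le_mul_of_nonneg_left ih (by linarith)

end Relaxed

end QNPDHG

/-! ### Contraction factors and assembly. -/

namespace QNPDHG

theorem ConvexWithModulus.anti {H : Type*} [NormedAddCommGroup H] [InnerProductSpace ℝ H]
    {μ μ' : ℝ} (h : μ ≤ μ') {g : H → EReal} (hg : ConvexWithModulus μ' g) :
    ConvexWithModulus μ g := fun x y a b ha hb hab => by
  refine le_trans ?_ (hg x y a b ha hb hab)
  gcongr

/-- One factor serves both kinds of strong convexity: `t` is the squared distance of the new point
(`g`, `f`) or of the extrapolated point (`G`, `F`), and `N` bounds the metric there. In the second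
case `X ≤ Y ≤ N * t` reduces to the first. -/
theorem exists_contraction {N μ : ℝ} (hN : 0 ≤ N) (hμ : 0 < μ) :
    ∃ q, 0 ≤ q ∧ q < 1 ∧ ∀ X Y t : ℝ, 0 ≤ t → X ≤ N * t ∨ Y ≤ N * t → X + μ * t ≤ Y →
      X ≤ q * Y := by
  refine ⟨(N + 1) / (N + 1 + μ), by positivity, ?_, fun X Y t ht hN' h => ?_⟩
  · rw [div_lt_one (by positivity)]; linarith
  · rw [div_mul_eq_mul_div, le_div_iff₀ (by positivity)]
    have h1 : X ≤ N * t := by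
      rcases hN' with h1 | h1
      · exact h1
      · linarith [mul_nonneg hμ.le ht]
    have h2 := mul_le_mul_of_nonneg_left h1 hμ.le
    have h3 := mul_le_mul_of_nonneg_left h (by linarith : 0 ≤ N + 1)
    linarith [mul_nonneg hμ.le ht]

section PrimalDual

variable {H₁ H₂ : Type*} [NormedAddCommGroup H₁] [InnerProductSpace ℝ H₁]
  [NormedAddCommGroup H₂] [InnerProductSpace ℝ H₂]
  {K : H₁ →L[ℝ] H₂} {g : H₁ → EReal} {f : H₂ → EReal} {G : H₁ → ℝ} {F : H₂ → ℝ}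

theorem StrongConvexityCondition.exists_modulus (h : StrongConvexityCondition g f G F) :
    ∃ μ > 0, (ConvexWithModulus μ g ∧ ConvexWithModulus μ f) ∨
      (StrongConvexOn Set.univ μ G ∧ StrongConvexOn Set.univ μ F) := by
  rcases h with ⟨⟨μ, hμ, h1⟩, ν, hν, h2⟩ | ⟨⟨μ, hμ, h1⟩, ν, hν, h2⟩
  · exact ⟨min μ ν, lt_min hμ hν,
      Or.inl ⟨h1.anti (min_le_left _ _), h2.anti (min_le_right _ _)⟩⟩
  · exact ⟨min μ ν, lt_min hμ hν,
      Or.inr ⟨h1.mono (min_le_left _ _), h2.mono (min_le_right _ _)⟩⟩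

variable [CompleteSpace H₁] [CompleteSpace H₂]

/-- Strong monotonicity of `A` between the step and the saddle point, where `-B p ∈ A p`. -/
theorem PDRel.le_inner_residual (hg : ProperConvexLSC g) (hf : ProperConvexLSC f) {μ : ℝ}
    (hgμ : ConvexWithModulus μ g) (hfμ : ConvexWithModulus μ f) (hG : Differentiable ℝ G)
    (hF : Differentiable ℝ F) {p z w : PD H₁ H₂} {M : PD H₁ H₂ →L[ℝ] PD H₁ H₂}
    (hp : IsSaddlePoint K g f G F p) (h : PDRel μ K g f w (M (z - w) - gradPair G F z)) :
    μ * ‖w - p‖ ^ 2 ≤ ⟪M (z - w) - gradPair G F z + gradPair G F p, w - p⟫_ℝ := by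
  have := h.inner_le (hp.pdRel hg hf hgμ hfμ hG hF)
  rwa [sub_neg_eq_add] at this

theorem IsMainStep.pdRel (hg : ProperConvexLSC g) (hf : ProperConvexLSC f) {μ : ℝ}
    (hgμ : ConvexWithModulus μ g) (hfμ : ConvexWithModulus μ f) {T : H₁ ≃L[ℝ] H₁}
    {S : H₂ ≃L[ℝ] H₂} (hT : IsStepOperator T) (hS : IsStepOperator S) {r : ℕ} {s : ℝ}
    {U : Rn r →L[ℝ] PD H₁ H₂} {ε z w : PD H₁ H₂} (h : IsMainStep K g f G F T S s U ε z w)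
    (hε : ε = 0) : PDRel μ K g f w (qnMetric K T S s U (z - w) - gradPair G F z) := by
  obtain ⟨e, he, hwe⟩ := h.exists_exact hg hf hgμ hfμ hT hS
  rw [hε, norm_zero, mul_zero] at hwe
  rw [sub_eq_zero.1 (norm_le_zero_iff.1 hwe)]
  exact he

end PrimalDual

end QNPDHG

theorem mainTheorem6 {H₁ H₂ : Type*}
    [NormedAddCommGroup H₁] [InnerProductSpace ℝ H₁] [CompleteSpace H₁]
    [NormedAddCommGroup H₂] [InnerProductSpace ℝ H₂] [CompleteSpace H₂]
    -- the saddle point problem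
    (K : H₁ →L[ℝ] H₂) (g : H₁ → EReal) (f : H₂ → EReal) (G : H₁ → ℝ) (F : H₂ → ℝ)
    (hg : ProperConvexLSC g) (hf : ProperConvexLSC f)
    (β : ℝ) (hβ : 0 < β) (hG : SmoothConvex (1 / β) G) (hF : SmoothConvex (1 / β) F)
    (hsol : ∃ z, IsSaddlePoint K g f G F z)
    -- the step-size operators and the low-rank parts of the metrics
    (T : H₁ ≃L[ℝ] H₁) (S : H₂ ≃L[ℝ] H₂) (hT : IsStepOperator T) (hS : IsStepOperator S)
    (r : ℕ) (U : ℕ → Rn r →L[ℝ] PD H₁ H₂) (s : ℕ → ℝ) (hs : ∀ k, s k = 1 ∨ s k = -1)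
    (M : ℕ → PD H₁ H₂ →L[ℝ] PD H₁ H₂) (hM : ∀ k, M k = qnMetric K T S (s k) (U k))
    (ε : ℕ → PD H₁ H₂) :
    -- (i) the inertial method
    (Assumption1 β M ε →
      ∀ (α : ℕ → ℝ) (Λ : ℝ) (zinit : PD H₁ H₂) (z : ℕ → PD H₁ H₂),
        (∀ k, 0 < α k ∧ α k ≤ Λ) →
        IsInertialQNPDHG K g f G F T S s U ε α zinit z →
        Summable (fun k => α k * max (mnorm (M k) (z k - prev zinit z k))
          (mnorm (M k) (z k - prev zinit z k) ^ 2)) →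
        ∃ z' : PD H₁ H₂, IsSaddlePoint K g f G F z' ∧ WeaklyTendsto z z' ∧
          (StrongConvexityCondition g f G F → (∀ k, ε k = 0) →
            (∃ e > 0, ∀ k, InS e (M k - (1 / β) • ContinuousLinearMap.id ℝ (PD H₁ H₂))) →
            ∃ δ ∈ Set.Ioo (0 : ℝ) 1, ∃ Θ > (0 : ℝ), ∃ K₀ : ℕ, ∀ k ≥ K₀,
              mnorm (M k) (z k - z') ^ 2 ≤
                (1 - δ) ^ (k - K₀) * mnorm (M K₀) (z K₀ - z') ^ 2 +
                ∑ i ∈ Finset.Ico K₀ k, Θ * (1 - δ) ^ (k - i) * α i *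
                  max (mnorm (M i) (z i - prev zinit z i))
                    (mnorm (M i) (z i - prev zinit z i) ^ 2))) ∧
    -- (ii) the method with relaxation
    (Assumption2 β M ε →
      ∀ z : ℕ → PD H₁ H₂,
        IsRelaxedQNPDHG K g f G F T S s U ε z →
        ∃ z' : PD H₁ H₂, IsSaddlePoint K g f G F z' ∧ WeaklyTendsto z z' ∧
          (StrongConvexityCondition g f G F → (∀ k, ε k = 0) →
            ∃ δ ∈ Set.Ioo (0 : ℝ) 1, ∀ k, ‖z k - z'‖ ^ 2 ≤ (1 - δ) ^ k * ‖z 0 - z'‖ ^ 2)) := by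
  obtain rfl : M = fun k => qnMetric K T S (s k) (U k) := funext hM
  have hGd := hG.differentiable
  have hFd := hF.differentiable
  have hB : Cocoercive β (gradPair G F) := gradPair_cocoercive hβ hG hF
  -- Demiclosedness in the form needed by both methods; `zb` is the point at which the main step is
  -- taken.
  have hclus : ∀ {zh zb : ℕ → PD H₁ H₂},
      (∀ k, PDRel 0 K g f (zh k)
        (qnMetric K T S (s k) (U k) (zb k - zh k) - gradPair G F (zb k))) →
      ∀ u : Ultrafilter ℕ, ∀ p, (∃ R, ∀ k, ‖zh k‖ ≤ R) →
      (∀ φ : StrongDual ℝ (PD H₁ H₂), Tendsto (fun k => φ (zh k)) u (𝓝 (φ p))) →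
      Tendsto (fun k => qnMetric K T S (s k) (U k) (zb k - zh k) - gradPair G F (zb k) +
        gradPair G F (zh k)) u (𝓝 0) → p ∈ {z | IsSaddlePoint K g f G F z} := by
    rintro zh zb hrel u p ⟨R, hR⟩ hp hu
    exact isSaddlePoint_of_weak_limit hg hf hGd hFd hG.convex hF.convex hR hp hu fun k => by
      rw [add_sub_cancel_right]; exact hrel k
  have hC : 0 ≤ 2 + (‖(S : H₂ →L[ℝ] H₂)‖ + 1) * (2 * ‖K‖) := by positivity
  refine ⟨fun hA α Λ zinit z hα hz hsum => ?_, fun hA z hz => ?_⟩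
  · choose zh hrel hzh using fun k => (hz k).exists_exact hg hf hg.convex hf.convex hT hS
    obtain ⟨⟨p, hp, hzp⟩, hdist⟩ := inertial_converges (zinit := zinit) hβ hB hA
      (fun k => (hα k).1.le) hsum hC hzh hsol
      (fun p hp k => by
        have := PDRel.le_inner_residual hg hf hg.convex hf.convex hGd hFd hp (hrel k)
        rwa [zero_mul] at this)
      (hclus hrel)
    refine ⟨p, hp, hzp, fun hsc hε hlow => ?_⟩
    obtain ⟨l, hl⟩ := hdist p hp
    obtain ⟨A, hA'⟩ := hl.bddAbove_range
    obtain ⟨e, he, hlow⟩ := hlow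
    obtain ⟨σ, hσ, hM'⟩ := hA.mem
    obtain ⟨N, hN⟩ := hA.bdd
    have hN : ∀ k, ‖qnMetric K T S (s k) (U k)‖ ≤ N := fun k => hN ⟨k, rfl⟩
    have hN0 : 0 ≤ N := (norm_nonneg (qnMetric K T S (s 0) (U 0))).trans (hN 0)
    obtain ⟨μ, hμ, hsc⟩ := hsc.exists_modulus
    obtain ⟨q, hq0, hq1, hq⟩ := exists_contraction hN0 hμ
    refine inertial_rate hA hα (fun k => hA' ⟨k, rfl⟩) hq0 hq1 fun k => ?_
    rw [mnorm_sq ((hM' k).pos hσ.le _), mnorm_sq ((hM' k).pos hσ.le _)]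
    have hd := (hlow k).add_le (extrap α zinit z k - z (k + 1))
    have hd0 : 0 ≤ e * ‖extrap α zinit z k - z (k + 1)‖ ^ 2 := by positivity
    have hbd : ∀ x, ⟪qnMetric K T S (s k) (U k) x, x⟫_ℝ ≤ N * ‖x‖ ^ 2 := fun x =>
      (inner_apply_self_le _ x).trans (by gcongr; exact hN k)
    rcases hsc with ⟨hgμ, hfμ⟩ | ⟨hGμ, hFμ⟩
    · have h1 := PDRel.le_inner_residual hg hf hgμ hfμ hGd hFd hp
        ((hz k).pdRel hg hf hgμ hfμ hT hS (hε k))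
      have h2 := forwardBackward_step hβ (inner_apply_comm (hM' k).1) hB h1
      have h3 : 1 / (2 * β) * ‖extrap α zinit z k - z (k + 1)‖ ^ 2 ≤
          1 / β * ‖extrap α zinit z k - z (k + 1)‖ ^ 2 := by
        gcongr; linarith
      have h4 : 0 ≤ μ * ‖z (k + 1) - p‖ ^ 2 := by positivity
      simp only [extrap] at *
      exact hq _ _ (‖z (k + 1) - p‖ ^ 2) (sq_nonneg _) (Or.inl (hbd _)) (by linarith)
    · have h1 := PDRel.le_inner_residual hg hf hg.convex hf.convex hGd hFd hp
        ((hz k).pdRel hg hf hg.convex hf.convex hT hS (hε k))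
      rw [zero_mul] at h1
      have h2 := forwardBackward_step_strong hβ (inner_apply_comm (hM' k).1) hB
        (gradPair_stronglyMonotone hGd hFd hGμ hFμ _ p) h1
      simp only [extrap] at *
      exact hq _ _ _ (sq_nonneg _) (Or.inr (hbd _)) (by linarith)
  · choose w hw hzw using hz
    choose zh hrel hzh using fun k => (hw k).exists_exact hg hf hg.convex hf.convex hT hS
    obtain ⟨p, hp, hzp⟩ := relaxed_converges hβ hB hA hzh hzw hsol
      (fun p hp k => by
        have := PDRel.le_inner_residual hg hf hg.convex hf.convex hGd hFd hp (hrel k)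
        rwa [zero_mul] at this)
      (hclus hrel)
    refine ⟨p, hp, hzp, fun hsc hε => ?_⟩
    obtain ⟨μ, hμ, hsc⟩ := hsc.exists_modulus
    refine relaxed_rate hβ hB hA hzw hμ fun k => ?_
    -- The residual splits into an `A`-part and a `B`-part; strong convexity makes one of them
    -- strongly monotone and the other is still monotone.
    rw [inner_residual_eq _ _ _ _ p]
    rcases hsc with ⟨hgμ, hfμ⟩ | ⟨hGμ, hFμ⟩
    · have h1 := PDRel.le_inner_residual hg hf hgμ hfμ hGd hFd hp
        ((hw k).pdRel hg hf hgμ hfμ hT hS (hε k))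
      have h2 := hB.inner_nonneg hβ (w k) p
      linarith
    · have h1 := PDRel.le_inner_residual hg hf hg.convex hf.convex hGd hFd hp
        ((hw k).pdRel hg hf hg.convex hf.convex hT hS (hε k))
      have h2 := gradPair_stronglyMonotone hGd hFd hGμ hFμ (w k) p
      linarith
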